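/- Let $C=\mathbb{R}+e\mathbb{R}$, $e^2=1$, be the algebra of para-complex numbers, and let $(M,I)$ be a para-complex manifold: a smooth manifold with a smooth field $I$ of endomorphisms of the tangent spaces such that $I^2=\mathrm{Id}$, $I\neq\pm\mathrm{Id}$, the eigenspaces of $I$ for $\pm1$ have equal dimension, and the Nijenhuis tensor of $I$ vanishes. Let $g$ be a para-Kähler Norden metric on $(M,I)$, that is, a smooth pseudo-Riemannian metric (nondegenerate, of any signature) with $g(IX,IY)=g(X,Y)$ whose Levi-Civita connection $\nabla$ satisfies $\nabla I=0$. Extend $I$ $C$-linearly to $TM\otimes C$, put $T^{1,0}M=\{Z\in TM\otimes C : IZ=eZ\}$ and $\widehat X=\frac12(X+eIX)\in T^{1,0}M$ for a real tangent vector $X$. Let $\widehat g$ be the associated para-complex metric: the symmetric $C$-bilinear form on $TM\otimes C$ determined by $$\widehat g(\widehat X,\widehat Y)=\tfrac12\big(g(X,Y)+e\,g(X,IY)\big),\qquad \widehat g(\overline Z,\overline W)=\overline{\widehat g(Z,W)},\qquad \widehat g(Z,\overline W)=0\quad(Z,W\in T^{1,0}M).$$ Let $R$ and $\widehat R$ be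 the curvature tensors of the Levi-Civita connections of $g$ (on $TM$) and of $\widehat g$ (on $TM\otimes C$), with the convention $R(X,Y)=[\nabla_X,\nabla_Y]-\nabla_{[X,Y]}$; define the Ricci tensors $$\mathrm{Ric}(g)(X,Y)=\mathrm{Tr}_{\mathbb R}\{Z\mapsto R(Z,X)Y\},\qquad \mathrm{Ric}(\widehat g)(\widehat X,\widehat Y)=\mathrm{Tr}_{C}\{\widehat Z\mapsto\widehat R(\widehat Z,\widehat X)\widehat Y\}\ \text{ (trace over } T^{1,0}M),$$ and the Ricci operators $Q$ on $TM$ and $\widehat Q$ on $T^{1,0}M$ by $g(QX,Y)=\mathrm{Ric}(g)(X,Y)$ and $\widehat g(\widehat Q\widehat X,\widehat Y)=\mathrm{Ric}(\widehat g)(\widehat X,\widehat Y)$. Then at every point of $M$, for all real tangent vectors $X,Y$, $$\mathrm{Ric}(g)(IX,Y)=\mathrm{Ric}(g)(X,IY),\qquad \mathrm{Ric}(g)(IX,IY)=\mathrm{Ric}(g)(X,Y),\qquad QI=IQ,$$ $$\mathrm{Ric}(\widehat g)(\widehat X,\widehat Y)=\tfrac12\big(\mathrm{Ric}(g)(X,Y)+e\,\mathrm{Ric}(g)(X,IY)\big),\qquad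 \widehat Q\widehat X=\widehat{QX}.$$ -/

import Mathlib

open scoped Manifold ContDiff TensorProduct
open Bundle

noncomputable section

namespace ParaNorden

/-! ### Para-complex numbers -/

/-- The algebra `C = ℝ + eℝ`, `e² = 1`, of para-complex numbers. -/
abbrev ParaComplex : Type := QuadraticAlgebra ℝ (1 : ℝ) 0

/-- The para-complex unit `e`. -/
def paraUnit : ParaComplex := ⟨0, 1⟩

theorem paraUnit_mul_self : paraUnit * paraUnit = 1 := by
  ext <;> simp [paraUnit, QuadraticAlgebra.re_one, QuadraticAlgebra.im_one]

/-! ### Levi-Civita connection, curvature and Ricci tensor in a coordinate frame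

The formulas below make sense for a symmetric matrix `G` of functions on (an open subset of) a
space `P` of coordinates with values in a commutative ring `K ⊇ ℝ`, once the derivatives `∂ i` of
`K`-valued functions along the commuting vector fields of the frame are given. They are used with
`K = ℝ` for the real metric and with `K = C` for its para-complex companion. -/

section Coordinates

variable {ι : Type*} [Fintype ι] [DecidableEq ι] {P : Type*} {K : Type*} [CommRing K] [Algebra ℝ K]

/-- Christoffel symbols of the second kind of `G`. The entry `(k, j)` of `christoffel pd G i p` is
`Γᵏᵢⱼ = ½ ∑ₗ Gᵏˡ (∂ᵢ Gⱼₗ + ∂ⱼ Gᵢₗ - ∂ₗ Gᵢⱼ)`, so that `∇_{∂ᵢ} ∂ⱼ = ∑ₖ Γᵏᵢⱼ ∂ₖ` for the Levi-Civita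
connection `∇` of `G`. -/
def christoffel (pd : ι → (P → K) → P → K) (G : P → Matrix ι ι K) (i : ι) (p : P) :
    Matrix ι ι K :=
  Matrix.of fun k j ↦ (1 / 2 : ℝ) • ∑ l, (G p)⁻¹ k l *
    (pd i (fun q ↦ G q j l) p + pd j (fun q ↦ G q i l) p - pd l (fun q ↦ G q i j) p)

/-- Components of the curvature `R(X, Y) = [∇_X, ∇_Y] - ∇_{[X, Y]}` of the Levi-Civita connection of
`G`: the entry `(k, l)` of `curvatureMatrix pd G i j p` is the `∂ₖ`-component of `R(∂ᵢ, ∂ⱼ) ∂ₗ`. -/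
def curvatureMatrix (pd : ι → (P → K) → P → K) (G : P → Matrix ι ι K) (i j : ι) (p : P) :
    Matrix ι ι K :=
  Matrix.of (fun k l ↦ pd i (fun q ↦ christoffel pd G j q k l) p
      - pd j (fun q ↦ christoffel pd G i q k l) p)
    + (christoffel pd G i p * christoffel pd G j p - christoffel pd G j p * christoffel pd G i p)

end Coordinates

section Linear

variable {ι : Type*} [Fintype ι] [DecidableEq ι] {K : Type*} [CommRing K]
  {V : Type*} [AddCommGroup V] [Module K V]

/-- The trilinear map `(X, Y, Z) ↦ R(X, Y) Z` with components `R i j` in the basis `B`. -/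
def trilinearOfMatrix (B : Module.Basis ι K V) (R : ι → ι → Matrix ι ι K) :
    V →ₗ[K] V →ₗ[K] V →ₗ[K] V :=
  B.constr K fun i ↦ B.constr K fun j ↦ Matrix.toLin B B (R i j)

/-- The bilinear form `(X, Y) ↦ Tr (Z ↦ R(Z, X) Y)`. -/
def ricciForm (R : V →ₗ[K] V →ₗ[K] V →ₗ[K] V) : LinearMap.BilinForm K V :=
  LinearMap.mk₂ K (fun X Y ↦ LinearMap.trace K V ((R.flip X).flip Y))
    (fun X X' Y ↦ by rw [← map_add]; congr 1; ext Z; simp)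
    (fun c X Y ↦ by rw [← map_smul]; congr 1; ext Z; simp)
    (fun X Y Y' ↦ by rw [← map_add]; congr 1; ext Z; simp)
    (fun c X Y ↦ by rw [← map_smul]; congr 1; ext Z; simp)

open Classical in
/-- The endomorphism `Q` of `V` determined by `b (Q X) Y = r X Y` for a nondegenerate (that is,
perfect) bilinear form `b` and a bilinear form `r`. -/
def raiseIndex (b r : LinearMap.BilinForm K V) : V →ₗ[K] V :=
  if h : Function.Bijective b then
    ((LinearEquiv.ofBijective b h).symm : (V →ₗ[K] K) →ₗ[K] V) ∘ₗ r
  else 0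

theorem raiseIndex_spec {b : LinearMap.BilinForm K V} (h : Function.Bijective b)
    (r : LinearMap.BilinForm K V) (X Y : V) : b (raiseIndex b r X) Y = r X Y := by
  have : b (raiseIndex b r X) = r X := by
    simpa only [raiseIndex, h, dif_pos] using! (LinearEquiv.ofBijective b h).apply_symm_apply (r X)
  rw [this]

end Linear

/-! ### Para-complex manifolds and para-Norden metrics -/

section Manifold

variable (E : Type*) [NormedAddCommGroup E] [NormedSpace ℝ E]
  (M : Type*) [TopologicalSpace M] [ChartedSpace E M] [IsManifold 𝓘(ℝ, E) ∞ M]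

/-- A para-complex structure on the smooth manifold `M`: a smooth field `I` of endomorphisms of the
tangent spaces with `I² = 1`, `I ≠ ±1`, eigenspaces of equal dimension, and vanishing Nijenhuis
tensor. -/
structure ParaComplexStructure where
  I (x : M) : TangentSpace 𝓘(ℝ, E) x →L[ℝ] TangentSpace 𝓘(ℝ, E) x
  smooth : ContMDiff 𝓘(ℝ, E) (𝓘(ℝ, E).prod 𝓘(ℝ, E →L[ℝ] E)) ∞
    (fun x ↦ TotalSpace.mk' (E →L[ℝ] E)
      (E := fun x : M ↦ TangentSpace 𝓘(ℝ, E) x →L[ℝ] TangentSpace 𝓘(ℝ, E) x) x (I x))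
  sq (x : M) (v : TangentSpace 𝓘(ℝ, E) x) : I x (I x v) = v
  ne_id (x : M) : I x ≠ ContinuousLinearMap.id ℝ _
  ne_neg_id (x : M) : I x ≠ -ContinuousLinearMap.id ℝ _
  finrank_eq (x : M) :
    Module.finrank ℝ (LinearMap.ker ((I x : TangentSpace 𝓘(ℝ, E) x →ₗ[ℝ] TangentSpace 𝓘(ℝ, E) x)
      - LinearMap.id)) =
    Module.finrank ℝ (LinearMap.ker ((I x : TangentSpace 𝓘(ℝ, E) x →ₗ[ℝ] TangentSpace 𝓘(ℝ, E) x)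
      + LinearMap.id))
  nijenhuis (X Y : Π x : M, TangentSpace 𝓘(ℝ, E) x)
    (hX : ContMDiff 𝓘(ℝ, E) 𝓘(ℝ, E).tangent ∞ (fun x ↦ (⟨x, X x⟩ : TangentBundle 𝓘(ℝ, E) M)))
    (hY : ContMDiff 𝓘(ℝ, E) 𝓘(ℝ, E).tangent ∞ (fun x ↦ (⟨x, Y x⟩ : TangentBundle 𝓘(ℝ, E) M)))
    (x : M) :
    VectorField.mlieBracket 𝓘(ℝ, E) (fun y ↦ I y (X y)) (fun y ↦ I y (Y y)) x
      - I x (VectorField.mlieBracket 𝓘(ℝ, E) (fun y ↦ I y (X y)) Y x)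
      - I x (VectorField.mlieBracket 𝓘(ℝ, E) X (fun y ↦ I y (Y y)) x)
      + VectorField.mlieBracket 𝓘(ℝ, E) X Y x = 0

variable {E M}

/-- A para-Norden metric on `(M, I)`: a smooth pseudo-Riemannian metric (of arbitrary signature)
with `g(IX, IY) = g(X, Y)`. -/
structure ParaNordenMetric (J : ParaComplexStructure E M) where
  g (x : M) : TangentSpace 𝓘(ℝ, E) x →L[ℝ] TangentSpace 𝓘(ℝ, E) x →L[ℝ] ℝ
  smooth : ContMDiff 𝓘(ℝ, E) (𝓘(ℝ, E).prod 𝓘(ℝ, E →L[ℝ] E →L[ℝ] ℝ)) ∞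
    (fun x ↦ TotalSpace.mk' (E →L[ℝ] E →L[ℝ] ℝ)
      (E := fun x : M ↦ TangentSpace 𝓘(ℝ, E) x →L[ℝ] TangentSpace 𝓘(ℝ, E) x →L[ℝ] ℝ) x (g x))
  symm (x : M) (u v : TangentSpace 𝓘(ℝ, E) x) : g x u v = g x v u
  nondegenerate (x : M) (u : TangentSpace 𝓘(ℝ, E) x) : (∀ v, g x u v = 0) → u = 0
  pure (x : M) (u v : TangentSpace 𝓘(ℝ, E) x) : g x (J.I x u) (J.I x v) = g x u v

/-! ### The para-complexified tangent spaces -/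

/-- The para-complexified tangent space `T_xM ⊗ C`. -/
abbrev TangentC (x : M) : Type _ := ParaComplex ⊗[ℝ] TangentSpace 𝓘(ℝ, E) x

namespace ParaComplexStructure

variable (J : ParaComplexStructure E M)

/-- `I_x` as a linear map. -/
def lin (x : M) : TangentSpace 𝓘(ℝ, E) x →ₗ[ℝ] TangentSpace 𝓘(ℝ, E) x := (J.I x).toLinearMap

/-- The `C`-linear extension of `I_x` to `T_xM ⊗ C`. -/
def linC (x : M) : TangentC (E := E) x →ₗ[ParaComplex] TangentC (E := E) x :=
  (J.lin x).baseChange ParaComplex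

theorem linC_linC (x : M) (Z : TangentC (E := E) x) : J.linC x (J.linC x Z) = Z := by
  have : (J.lin x) ∘ₗ (J.lin x) = LinearMap.id := by
    ext v; exact J.sq x v
  rw [linC, ← LinearMap.comp_apply, ← LinearMap.baseChange_comp, this, LinearMap.baseChange_id,
    LinearMap.id_apply]

/-- `T^{1,0}_xM = {Z ∈ T_xM ⊗ C | IZ = eZ}`. -/
def T10 (x : M) : Submodule ParaComplex (TangentC (E := E) x) :=
  LinearMap.eqLocus (J.linC x) (paraUnit • LinearMap.id)

theorem mem_T10 {x : M} {Z : TangentC (E := E) x} :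
    Z ∈ J.T10 x ↔ J.linC x Z = paraUnit • Z := Iff.rfl

/-- The projection `Z ↦ ½ (Z + e IZ)` of `T_xM ⊗ C = T^{1,0} ⊕ T^{0,1}` onto `T^{1,0}`. -/
def proj10 (x : M) : TangentC (E := E) x →ₗ[ParaComplex] J.T10 x :=
  LinearMap.codRestrict (J.T10 x)
    (algebraMap ℝ ParaComplex (1 / 2) • (LinearMap.id + paraUnit • J.linC x)) (fun Z ↦ by
      rw [mem_T10]
      simp only [LinearMap.smul_apply, LinearMap.add_apply, LinearMap.id_apply, map_smul, map_add,
        linC_linC]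
      rw [smul_comm paraUnit (algebraMap ℝ ParaComplex (1 / 2)), smul_add paraUnit,
        smul_smul paraUnit paraUnit, paraUnit_mul_self, one_smul, smul_add, smul_add, add_comm])

/-- `X̂ = ½ (X + e IX) ∈ T^{1,0}` for a real tangent vector `X`. -/
def hat (x : M) (X : TangentSpace 𝓘(ℝ, E) x) : J.T10 x := J.proj10 x (1 ⊗ₜ X)

theorem coe_hat (x : M) (X : TangentSpace 𝓘(ℝ, E) x) :
    (J.hat x X : TangentC (E := E) x) =
      algebraMap ℝ ParaComplex (1 / 2) • (1 ⊗ₜ X + paraUnit • (1 ⊗ₜ (J.I x X))) := by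
  simp [hat, proj10, linC, lin]

end ParaComplexStructure

namespace ParaNordenMetric

variable {J : ParaComplexStructure E M} (g : ParaNordenMetric J)

/-- `g_x` as a bilinear form. -/
def form (x : M) : LinearMap.BilinForm ℝ (TangentSpace 𝓘(ℝ, E) x) :=
  LinearMap.mk₂ ℝ (fun u v ↦ g.g x u v) (by simp) (by simp) (by simp) (by simp)

/-- The para-complex metric `ĝ_x` on `T_xM ⊗ C` associated with `g`. It is determined by `C`-bilinearity
and the three properties `hatForm_hat_hat`, `hatForm_conj`, `hatForm_eq_zero` below. -/
def hatForm (x : M) : LinearMap.BilinForm ParaComplex (TangentC (E := E) x) :=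
  (g.form x).baseChange ParaComplex

theorem pure' (x : M) (u v : TangentSpace 𝓘(ℝ, E) x) : g.g x (J.I x u) v = g.g x u (J.I x v) := by
  rw [← g.pure x u, J.sq]

/-- `ĝ(X̂, Ŷ) = ½ (g(X, Y) + e g(X, IY))`. -/
theorem hatForm_hat_hat (x : M) (X Y : TangentSpace 𝓘(ℝ, E) x) :
    g.hatForm x (J.hat x X) (J.hat x Y) =
      (1 / 2 : ℝ) • (algebraMap ℝ ParaComplex (g.g x X Y)
        + paraUnit * algebraMap ℝ ParaComplex (g.g x X (J.I x Y))) := by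
  simp only [J.coe_hat, hatForm, map_smul, map_add, LinearMap.smul_apply, LinearMap.add_apply,
    LinearMap.BilinForm.baseChange_tmul, form, LinearMap.mk₂_apply, g.pure, g.pure']
  ext <;> simp [paraUnit, QuadraticAlgebra.re_one, QuadraticAlgebra.im_one] <;> ring

/-- `ĝ(Z̄, W̄)` is the conjugate of `ĝ(Z, W)`, on generators of `T_xM ⊗ C`. -/
theorem hatForm_conj (x : M) (a b : ParaComplex) (X Y : TangentSpace 𝓘(ℝ, E) x) :
    g.hatForm x (star a ⊗ₜ X) (star b ⊗ₜ Y) = star (g.hatForm x (a ⊗ₜ X) (b ⊗ₜ Y)) := by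
  simp only [hatForm, LinearMap.BilinForm.baseChange_tmul]
  ext
  · simp
  · simp; ring

/-- `ĝ(Z, W) = 0` for `Z ∈ T^{1,0}` and `W ∈ T^{0,1}`, that is `IZ = eZ` and `IW = -eW`. -/
theorem hatForm_eq_zero (x : M) (Z W : TangentC (E := E) x) (hZ : J.linC x Z = paraUnit • Z)
    (hW : J.linC x W = -(paraUnit • W)) : g.hatForm x Z W = 0 := by
  have key : g.hatForm x (J.linC x Z) (J.linC x W) = g.hatForm x Z W := by
    clear hZ hW
    induction Z using TensorProduct.induction_on with
    | zero => simp
    | add a b ha hb => simp only [map_add, LinearMap.add_apply, ha, hb]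
    | tmul a X =>
      induction W using TensorProduct.induction_on with
      | zero => simp
      | add c d hc hd => simp only [map_add, hc, hd]
      | tmul b Y =>
        simp [hatForm, ParaComplexStructure.linC, ParaComplexStructure.lin, form, g.pure]
  rw [hZ, hW, map_neg, map_smul, map_smul, LinearMap.smul_apply, smul_smul, paraUnit_mul_self,
    one_smul] at key
  have h := congrArg QuadraticAlgebra.re key
  have h' := congrArg QuadraticAlgebra.im key
  simp only [QuadraticAlgebra.re_neg, QuadraticAlgebra.im_neg] at h h'
  ext
  · simp only [QuadraticAlgebra.re_zero]; linarith
  · simp only [QuadraticAlgebra.im_zero]; linarith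

/-! ### Levi-Civita connection, curvature and Ricci tensors of `g` and `ĝ`

Everything is computed in a chart `φ` of `M`, whose real coordinates refer to the fixed basis
`Module.finBasis ℝ E` of the model space. The coordinate vector fields `∂ᵢ` form a frame of `TM`
and, as `1 ⊗ ∂ᵢ`, a `C`-frame of `TM ⊗ C`. Both frames commute. -/

variable [FiniteDimensional ℝ E]

/-- `∂f/∂xⁱ` for a real function `f` of the coordinates. -/
def pderiv (i : Fin (Module.finrank ℝ E)) (f : E → ℝ) (p : E) : ℝ :=
  fderiv ℝ f p (Module.finBasis ℝ E i)

/-- `∂f/∂xⁱ` for a para-complex function `f` of the coordinates. -/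
def pderivC (i : Fin (Module.finrank ℝ E)) (f : E → ParaComplex) (p : E) : ParaComplex :=
  ⟨pderiv i (fun q ↦ (f q).re) p, pderiv i (fun q ↦ (f q).im) p⟩

/-- The coordinate vector `∂ᵢ` at the point with coordinates `p`. -/
def coordVec (φ : OpenPartialHomeomorph M E) (p : E) (i : Fin (Module.finrank ℝ E)) :
    TangentSpace 𝓘(ℝ, E) (φ.symm p) :=
  mfderiv 𝓘(ℝ, E) 𝓘(ℝ, E) φ.symm p (Module.finBasis ℝ E i)

/-- The coordinate vectors as a basis of `T_xM`, for `x` in the domain of the chart `φ`. -/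
def coordBasis {φ : OpenPartialHomeomorph M E} (hφ : φ ∈ atlas E M) {x : M} (hx : x ∈ φ.source) :
    Module.Basis (Fin (Module.finrank ℝ E)) ℝ (TangentSpace 𝓘(ℝ, E) x) :=
  Module.Basis.map (M' := TangentSpace 𝓘(ℝ, E) x) (Module.finBasis ℝ E)
    ((mdifferentiable_of_mem_atlas (I := 𝓘(ℝ, E)) hφ).mfderiv hx).symm.toLinearEquiv

/-- The components `Iⁱⱼ` of the para-complex structure in the chart `φ`. -/
def _root_.ParaNorden.ParaComplexStructure.coordMatrix (J : ParaComplexStructure E M)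
    (φ : OpenPartialHomeomorph M E) (p : E) :
    Matrix (Fin (Module.finrank ℝ E)) (Fin (Module.finrank ℝ E)) ℝ :=
  Matrix.of fun i j ↦ (Module.finBasis ℝ E).repr
    (mfderiv 𝓘(ℝ, E) 𝓘(ℝ, E) φ (φ.symm p) (J.I (φ.symm p) (coordVec φ p j))) i

/-- The components `gᵢⱼ = g(∂ᵢ, ∂ⱼ)` in the chart `φ`. -/
def coordMatrix (φ : OpenPartialHomeomorph M E) (p : E) :
    Matrix (Fin (Module.finrank ℝ E)) (Fin (Module.finrank ℝ E)) ℝ :=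
  Matrix.of fun i j ↦ g.g (φ.symm p) (coordVec φ p i) (coordVec φ p j)

/-- The components `ĝᵢⱼ = ĝ(∂ᵢ, ∂ⱼ)` in the chart `φ`. -/
def coordMatrixC (φ : OpenPartialHomeomorph M E) (p : E) :
    Matrix (Fin (Module.finrank ℝ E)) (Fin (Module.finrank ℝ E)) ParaComplex :=
  Matrix.of fun i j ↦ g.hatForm (φ.symm p) (1 ⊗ₜ coordVec φ p i) (1 ⊗ₜ coordVec φ p j)

/-- `g` is para-Kähler: its Levi-Civita connection satisfies `∇I = 0`. In coordinates,
`(∇ₖI)ⁱⱼ = ∂ₖIⁱⱼ + Γⁱₖₘ Iᵐⱼ - Iⁱₘ Γᵐₖⱼ`. -/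
def IsParaKahler : Prop :=
  ∀ φ ∈ atlas E M, ∀ p ∈ φ.target, ∀ k,
    Matrix.of (fun i j ↦ pderiv k (fun q ↦ J.coordMatrix φ q i j) p)
      + christoffel pderiv (g.coordMatrix φ) k p * J.coordMatrix φ p
      - J.coordMatrix φ p * christoffel pderiv (g.coordMatrix φ) k p = 0

section

variable {φ : OpenPartialHomeomorph M E} (hφ : φ ∈ atlas E M) {x : M} (hx : x ∈ φ.source)

/-- The curvature tensor `R(X, Y) Z` of the Levi-Civita connection of `g`, at `x`. -/
def riemann : TangentSpace 𝓘(ℝ, E) x →ₗ[ℝ] TangentSpace 𝓘(ℝ, E) x →ₗ[ℝ]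
    TangentSpace 𝓘(ℝ, E) x →ₗ[ℝ] TangentSpace 𝓘(ℝ, E) x :=
  trilinearOfMatrix (coordBasis hφ hx)
    fun i j ↦ curvatureMatrix pderiv (g.coordMatrix φ) i j (φ x)

/-- The Ricci tensor `Ric(g)(X, Y) = Tr (Z ↦ R(Z, X) Y)` at `x`. -/
def ricci : LinearMap.BilinForm ℝ (TangentSpace 𝓘(ℝ, E) x) := ricciForm (g.riemann hφ hx)

/-- The Ricci operator, `g(QX, Y) = Ric(g)(X, Y)`. -/
def ricciOp : TangentSpace 𝓘(ℝ, E) x →ₗ[ℝ] TangentSpace 𝓘(ℝ, E) x :=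
  raiseIndex (g.form x) (g.ricci hφ hx)

/-- The curvature tensor `R̂(Z, W) U` of the Levi-Civita connection of `ĝ` on `TM ⊗ C`, at `x`. -/
def riemannC : TangentC (E := E) x →ₗ[ParaComplex] TangentC (E := E) x →ₗ[ParaComplex]
    TangentC (E := E) x →ₗ[ParaComplex] TangentC (E := E) x :=
  trilinearOfMatrix ((coordBasis hφ hx).baseChange ParaComplex)
    fun i j ↦ curvatureMatrix pderivC (g.coordMatrixC φ) i j (φ x)

/-- The curvature tensor of `ĝ` on `T^{1,0}`: the `T^{1,0}`-component of `R̂(Z, W) U` for `Z`, `W`,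
`U` in `T^{1,0}`. (If `g` is para-Kähler, then `R̂(Z, W) U` already lies in `T^{1,0}`.) -/
def riemann10 : J.T10 x →ₗ[ParaComplex] J.T10 x →ₗ[ParaComplex]
    J.T10 x →ₗ[ParaComplex] J.T10 x :=
  LinearMap.mk₂ ParaComplex
    (fun Z W ↦ J.proj10 x ∘ₗ g.riemannC hφ hx Z W ∘ₗ (J.T10 x).subtype)
    (fun Z Z' W ↦ by ext U; simp)
    (fun c Z W ↦ by ext U; simp)
    (fun Z W W' ↦ by ext U; simp)
    (fun c Z W ↦ by ext U; simp)

/-- The Ricci tensor `Ric(ĝ)(X̂, Ŷ) = Tr (Ẑ ↦ R̂(Ẑ, X̂) Ŷ)` of `ĝ` at `x`, the trace being the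
`C`-linear trace over `T^{1,0}_xM`. -/
def ricciHat : LinearMap.BilinForm ParaComplex (J.T10 x) :=
  ricciForm (K := ParaComplex) (V := J.T10 x) (g.riemann10 hφ hx)

/-- The metric `ĝ` on `T^{1,0}_xM`. -/
def form10 (x : M) : LinearMap.BilinForm ParaComplex (J.T10 x) :=
  (g.hatForm x).domRestrict₁₂ (J.T10 x) (J.T10 x)

/-- The Ricci operator of `ĝ` on `T^{1,0}`, `ĝ(Q̂X̂, Ŷ) = Ric(ĝ)(X̂, Ŷ)`. -/
def ricciOpHat : J.T10 x →ₗ[ParaComplex] J.T10 x :=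
  raiseIndex (K := ParaComplex) (V := J.T10 x) (g.form10 x) (g.ricciHat hφ hx)

end

end ParaNordenMetric

end Manifold

end ParaNorden

end

noncomputable section

namespace ParaNorden

/-! ### Linear algebra over the para-complex numbers -/

/-! The point is that `R` is trilinear over `C` when `e` acts on tangent vectors through `I`; the
rest is linear algebra over `C`.

Since `I` is parallel, `R(X, Y)` commutes with `I` (`curvatureMatrix_commute`, `riemann_I`). As `I`
is self-adjoint, pair symmetry moves this to the first pair: `R(IX, Y) = R(X, IY)`. The first
Bianchi identity then forces `R(IX, Y)Z = I R(X, Y)Z` (`curvature_apply_left`).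

In the real frame `1 ⊗ ∂ᵢ` the components of `ĝ` are those of `g`, so `R̂` is the `C`-trilinear
extension of `R` (`riemannC_tmul`). The map `X ↦ X̂` is an isomorphism of `T_xM` onto `T^{1,0}`
carrying `I` to multiplication by `e`, so `C`-trilinearity gives `R̂(X̂, Ŷ)Ẑ = (R(X, Y)Z)^`
(`riemannC_hat`).

Finally, `T^{1,0}` is free over `C`, and an endomorphism `A` commuting with `I` has `C`-trace `½ (Tr
A + e Tr IA)` (`trace_eq_of_hat`). For `A = R(·, X)Y` this is the formula for `Ric(ĝ)`; the
statements on Ricci operators follow by nondegeneracy of `g` and `ĝ`. -/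

instance {E M : Type*} [NormedAddCommGroup E] [NormedSpace ℝ E] [FiniteDimensional ℝ E]
    [TopologicalSpace M] [ChartedSpace E M] (x : M) :
    FiniteDimensional ℝ (TangentSpace 𝓘(ℝ, E) x) :=
  inferInstanceAs (FiniteDimensional ℝ E)

@[simp] theorem paraUnit_re : paraUnit.re = 0 := rfl

@[simp] theorem paraUnit_im : paraUnit.im = 1 := rfl

/-- The trace of a `C`-linear endomorphism of a free module, seen as a real endomorphism `A`, is
twice the real part of its `C`-linear trace. -/
theorem trace_eq_two_mul_re {V W : Type*} [AddCommGroup V] [Module ℝ V]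
    [AddCommMonoid W] [Module ParaComplex W] [Module ℝ W]
    [IsScalarTower ℝ ParaComplex W] [Module.Free ParaComplex W] [Module.Finite ParaComplex W]
    (e : V ≃ₗ[ℝ] W) (F : W →ₗ[ParaComplex] W) (A : V →ₗ[ℝ] V) (h : ∀ v, F (e v) = e (A v)) :
    LinearMap.trace ℝ V A = 2 * (LinearMap.trace ParaComplex W F).re := by
  classical
  let b := Module.Free.chooseBasis ParaComplex W
  let c := QuadraticAlgebra.basis (R := ℝ) 1 0
  have hc0 : c 0 = 1 := by
    apply c.repr.injective; ext i; fin_cases i <;>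
      simp [c, QuadraticAlgebra.basis_repr_apply, QuadraticAlgebra.re_one, QuadraticAlgebra.im_one]
  have hc1 : c 1 = paraUnit := by
    apply c.repr.injective; ext i; fin_cases i <;> simp [c, QuadraticAlgebra.basis_repr_apply]
  have hA (v : W) : e (A (e.symm v)) = F v := by rw [← h, e.apply_symm_apply]
  have hre (s : Finset (Module.Free.ChooseBasisIndex ParaComplex W))
      (f : Module.Free.ChooseBasisIndex ParaComplex W → ParaComplex) :
      (∑ i ∈ s, f i).re = ∑ i ∈ s, (f i).re :=
    map_sum (QuadraticAlgebra.reₗ (R := ℝ) 1 0) f s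
  rw [LinearMap.trace_eq_matrix_trace ParaComplex b, Matrix.trace, hre,
    LinearMap.trace_eq_matrix_trace ℝ ((c.smulTower b).map e.symm), Matrix.trace,
    Fintype.sum_prod_type,
    Fin.sum_univ_two, ← Finset.sum_add_distrib, Finset.mul_sum]
  -- A diagonal entry `a + be` acts on `C` in the real basis `1, e` with both diagonal entries equal
  -- to `a`, hence with trace `2a`.
  refine Finset.sum_congr rfl fun k _ ↦ ?_
  simp only [Matrix.diag_apply, LinearMap.toMatrix_apply, Module.Basis.map_repr,
    Module.Basis.map_apply, LinearEquiv.trans_apply, LinearEquiv.symm_symm, hA,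
    Module.Basis.smulTower_repr, Module.Basis.smulTower_apply, map_smul, hc0, hc1]
  simp [c, QuadraticAlgebra.basis_repr_apply]
  ring

/-! ### The module `T^{1,0}` and its identification with the real tangent space. -/

namespace ParaComplexStructure

variable {E : Type*} [NormedAddCommGroup E] [NormedSpace ℝ E]
  {M : Type*} [TopologicalSpace M] [ChartedSpace E M] (x : M)

/-- Every element of `T_xM ⊗ C` is of the form `X + eY`. -/
theorem exists_eq_add_smul (Z : TangentC (E := E) x) :
    ∃ X Y : TangentSpace 𝓘(ℝ, E) x, Z = 1 ⊗ₜ X + paraUnit • (1 ⊗ₜ Y) := by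
  induction Z using TensorProduct.induction_on with
  | zero => exact ⟨0, 0, by simp⟩
  | add Z W hZ hW =>
    obtain ⟨X, Y, rfl⟩ := hZ
    obtain ⟨X', Y', rfl⟩ := hW
    exact ⟨X + X', Y + Y', by simp only [TensorProduct.tmul_add, smul_add]; abel⟩
  | tmul c X =>
    refine ⟨c.re • X, c.im • X, ?_⟩
    rw [TensorProduct.smul_tmul', ← TensorProduct.smul_tmul, ← TensorProduct.smul_tmul,
      ← TensorProduct.add_tmul]
    congr 1
    ext <;> simp [QuadraticAlgebra.re_one, QuadraticAlgebra.im_one]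

variable (E) in
/-- The real part `X + eY ↦ X` of elements of `T_xM ⊗ C`. -/
def realPart : TangentC (E := E) x →ₗ[ℝ] TangentSpace 𝓘(ℝ, E) x :=
  (TensorProduct.lid ℝ _).toLinearMap ∘ₗ (QuadraticAlgebra.reₗ (R := ℝ) 1 0).rTensor _

@[simp] theorem realPart_tmul (c : ParaComplex) (X : TangentSpace 𝓘(ℝ, E) x) :
    realPart E x (c ⊗ₜ X) = c.re • X := by
  simp [realPart]

theorem realPart_paraUnit_smul (X Y : TangentSpace 𝓘(ℝ, E) x) :
    realPart E x (paraUnit • (1 ⊗ₜ X + paraUnit • (1 ⊗ₜ Y))) = Y := by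
  rw [smul_add, smul_smul, paraUnit_mul_self, one_smul, TensorProduct.smul_tmul', map_add,
    realPart_tmul, realPart_tmul]
  simp [QuadraticAlgebra.re_one]

variable [IsManifold 𝓘(ℝ, E) ∞ M] (J : ParaComplexStructure E M)

/-- `X ↦ X̂` as a real linear map. -/
def hatₗ : TangentSpace 𝓘(ℝ, E) x →ₗ[ℝ] J.T10 x where
  toFun := J.hat x
  map_add' X Y := by simp [hat, TensorProduct.tmul_add]
  map_smul' c X := by
    simp only [hat, TensorProduct.tmul_smul, RingHom.id_apply]
    rw [algebra_compatible_smul ParaComplex c, map_smul, algebraMap_smul]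

@[simp] theorem hatₗ_apply (X : TangentSpace 𝓘(ℝ, E) x) : J.hatₗ x X = J.hat x X := rfl

theorem realPart_hat (X : TangentSpace 𝓘(ℝ, E) x) :
    realPart E x (J.hat x X) = (1 / 2 : ℝ) • X := by
  rw [J.coe_hat, algebraMap_smul, map_smul, map_add, TensorProduct.smul_tmul', realPart_tmul,
    realPart_tmul]
  simp [QuadraticAlgebra.re_one]

theorem hat_injective : Function.Injective (J.hat x) := fun X Y h ↦ by
  have := congrArg (fun Z : J.T10 x ↦ (2 : ℝ) • realPart E x Z) h
  simpa [realPart_hat] using this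

/-- `(IX)^ = e X̂`. -/
theorem hat_I (X : TangentSpace 𝓘(ℝ, E) x) : J.hat x (J.I x X) = paraUnit • J.hat x X := by
  apply Subtype.ext
  rw [Submodule.coe_smul, J.coe_hat, J.coe_hat, J.sq, smul_smul, mul_comm, ← smul_smul,
    smul_add paraUnit, smul_smul paraUnit paraUnit, paraUnit_mul_self, one_smul, add_comm]

theorem hat_surjective : Function.Surjective (J.hat x) := fun ⟨Z, hZ⟩ ↦ by
  obtain ⟨X, Y, rfl⟩ := exists_eq_add_smul x Z
  have h := congrArg (realPart E x) (J.mem_T10.1 hZ)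
  rw [realPart_paraUnit_smul, map_add, map_smul, map_add] at h
  simp only [linC, LinearMap.baseChange_tmul, TensorProduct.smul_tmul', realPart_tmul] at h
  -- Real parts of `I(X + eY) = e(X + eY)`: the left side gives `IX`, the right side `Y`. So the
  -- vector is `X + eIX`, the hat of `2X`.
  have hY : Y = J.I x X := by simpa [QuadraticAlgebra.re_one, lin] using h.symm
  refine ⟨(2 : ℝ) • X, Subtype.ext ?_⟩
  subst hY
  rw [J.coe_hat, algebraMap_smul, map_smul, TensorProduct.tmul_smul, TensorProduct.tmul_smul,
    smul_comm paraUnit (2 : ℝ), ← smul_add, smul_smul]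
  norm_num

/-- `X ↦ X̂` as a real linear isomorphism of `T_xM` onto `T^{1,0}_xM`. -/
def hatEquiv : TangentSpace 𝓘(ℝ, E) x ≃ₗ[ℝ] J.T10 x :=
  LinearEquiv.ofBijective (J.hatₗ x) ⟨J.hat_injective x, J.hat_surjective x⟩

@[simp] theorem hatEquiv_apply (X : TangentSpace 𝓘(ℝ, E) x) : J.hatEquiv x X = J.hat x X := rfl

variable [FiniteDimensional ℝ E]

instance : Module.Finite ParaComplex (J.T10 x) :=
  haveI : Module.Finite ℝ (J.T10 x) := Module.Finite.equiv (J.hatEquiv x)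
  Module.Finite.of_restrictScalars_finite ℝ ParaComplex (J.T10 x)

/-- As the eigenspaces of `I` have equal dimension, `T^{1,0}_xM` is a free module. -/
instance : Module.Free ParaComplex (J.T10 x) := by
  set P := LinearMap.ker (J.lin x - LinearMap.id) with hP
  set N := LinearMap.ker (J.lin x + LinearMap.id) with hN
  have hfin : Module.finrank ℝ P = Module.finrank ℝ N := J.finrank_eq x
  have memP {v} : v ∈ P ↔ J.I x v = v := by
    rw [hP, LinearMap.mem_ker, LinearMap.sub_apply, LinearMap.id_apply, sub_eq_zero]; rfl
  have memN {v} : v ∈ N ↔ J.I x v = -v := by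
    rw [hN, LinearMap.mem_ker, LinearMap.add_apply, LinearMap.id_apply, add_eq_zero_iff_eq_neg]; rfl
  have hcompl : IsCompl P N := by
    refine IsCompl.of_eq ?_ ?_
    · rw [Submodule.eq_bot_iff]
      rintro v ⟨h1, h2⟩
      have h := (memP.1 h1).symm.trans (memN.1 h2)
      have h2 : (2 : ℝ) • v = 0 := by rw [two_smul]; nth_rewrite 1 [h]; exact neg_add_cancel v
      exact (smul_eq_zero.1 h2).resolve_left two_ne_zero
    · rw [Submodule.eq_top_iff']
      intro v
      have : v = (1 / 2 : ℝ) • (v + J.I x v) + (1 / 2 : ℝ) • (v - J.I x v) := by module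
      rw [this]
      refine Submodule.add_mem_sup (Submodule.smul_mem _ _ (memP.2 ?_))
        (Submodule.smul_mem _ _ (memN.2 ?_))
      · rw [map_add, J.sq, add_comm]
      · rw [map_sub, J.sq, neg_sub]
  -- Equal dimensions enter here. The vectors `v + θ v` with `v` in a basis of `P` are to become a
  -- `C`-basis: `I` sends `v + θ v` to `v - θ v`, so each one generates both `v` and `θ v` over `C`.
  -- Freeness matters because `LinearMap.trace` is zero by default when there is no finite basis.
  let θ : P ≃ₗ[ℝ] N := LinearEquiv.ofFinrankEq P N hfin
  let u : P →ₗ[ℝ] TangentSpace 𝓘(ℝ, E) x := P.subtype + N.subtype ∘ₗ θ.toLinearMap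
  have hu (v : P) : u v = v + θ v := rfl
  let f : ParaComplex ⊗[ℝ] P →ₗ[ParaComplex] J.T10 x :=
    (TensorProduct.isBaseChange ℝ P ParaComplex).lift (J.hatₗ x ∘ₗ u)
  have hf (v : P) : f (1 ⊗ₜ v) = J.hat x (u v) :=
    (TensorProduct.isBaseChange ℝ P ParaComplex).lift_eq (J.hatₗ x ∘ₗ u) v
  have hrange (v : P) : J.hat x v ∈ LinearMap.range f ∧ J.hat x (θ v) ∈ LinearMap.range f := by
    have h1 : J.hat x (u v) ∈ LinearMap.range f := ⟨_, hf v⟩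
    have h2 : J.hat x (J.I x (u v)) ∈ LinearMap.range f := by
      rw [hat_I]; exact Submodule.smul_mem _ _ h1
    have hI : J.I x (u v) = v - θ v := by
      rw [hu, map_add, memP.1 v.2, memN.1 (θ v).2, sub_eq_add_neg]
    have hv : (v : TangentSpace 𝓘(ℝ, E) x) = (1 / 2 : ℝ) • (u v + J.I x (u v)) := by
      rw [hI, hu]; module
    have hθ : (θ v : TangentSpace 𝓘(ℝ, E) x) = (1 / 2 : ℝ) • (u v + (-1 : ℝ) • J.I x (u v)) := by
      rw [hI, hu]; module
    constructor
    · rw [hv, ← hatₗ_apply, map_smul, map_add]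
      exact Submodule.smul_of_tower_mem _ _ (add_mem h1 h2)
    · rw [hθ, ← hatₗ_apply, map_smul, map_add, map_smul]
      exact Submodule.smul_of_tower_mem _ _ (add_mem h1 (Submodule.smul_of_tower_mem _ _ h2))
  have hsurj : Function.Surjective f := by
    intro Z
    obtain ⟨X, rfl⟩ := J.hat_surjective x Z
    obtain ⟨p, hp, n, hn, rfl⟩ := Submodule.mem_sup.1
      (hcompl.sup_eq_top ▸ Submodule.mem_top : X ∈ P ⊔ N)
    have h := add_mem (hrange ⟨p, hp⟩).1 (hrange (θ.symm ⟨n, hn⟩)).2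
    rw [θ.apply_symm_apply] at h
    rw [← hatₗ_apply, map_add]
    exact h
  have hrank : Module.finrank ℝ (ParaComplex ⊗[ℝ] P) =
      Module.finrank ℝ (TangentSpace 𝓘(ℝ, E) x) := by
    rw [Module.finrank_tensorProduct, QuadraticAlgebra.finrank_eq_two,
      ← Submodule.finrank_add_eq_of_isCompl hcompl, ← hfin, two_mul]
  let f' : ParaComplex ⊗[ℝ] P →ₗ[ℝ] TangentSpace 𝓘(ℝ, E) x :=
    (J.hatEquiv x).symm.toLinearMap ∘ₗ f.restrictScalars ℝ
  -- Both sides have real dimension `dim P + dim N`, so surjectivity suffices.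
  have hinj' : Function.Injective f' :=
    (LinearMap.injective_iff_surjective_of_finrank_eq_finrank hrank).2
      ((J.hatEquiv x).symm.surjective.comp hsurj)
  have hinj : Function.Injective f := fun a b h ↦ hinj' (congrArg (J.hatEquiv x).symm h)
  exact Module.Free.of_equiv (LinearEquiv.ofBijective f ⟨hinj, hsurj⟩)

/-- The `C`-linear trace of an endomorphism `X̂ ↦ (AX)^` of `T^{1,0}_xM`. -/
theorem trace_eq_of_hat (F : J.T10 x →ₗ[ParaComplex] J.T10 x)
    (A : TangentSpace 𝓘(ℝ, E) x →ₗ[ℝ] TangentSpace 𝓘(ℝ, E) x)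
    (h : ∀ X, F (J.hat x X) = J.hat x (A X)) :
    LinearMap.trace ParaComplex _ F = (1 / 2 : ℝ) • (algebraMap ℝ ParaComplex
      (LinearMap.trace ℝ _ A) + paraUnit * algebraMap ℝ ParaComplex
        (LinearMap.trace ℝ _ (J.lin x ∘ₗ A))) := by
  have h1 := trace_eq_two_mul_re (J.hatEquiv x) F A h
  -- The real part of `e z` is the imaginary part of `z`, so the imaginary part of the trace is read
  -- off from `eF`, which corresponds to `IA`.
  have h2 := trace_eq_two_mul_re (J.hatEquiv x) (paraUnit • F) (J.lin x ∘ₗ A) fun X ↦ by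
    rw [LinearMap.smul_apply, J.hatEquiv_apply, h, ← hat_I]; rfl
  rw [map_smul, smul_eq_mul] at h2
  rw [h1, h2]
  ext <;> simp

end ParaComplexStructure

/-! ### Nondegeneracy of `g` and of `ĝ` on `T^{1,0}`. -/

namespace ParaNordenMetric

variable {E : Type*} [NormedAddCommGroup E] [NormedSpace ℝ E]
  {M : Type*} [TopologicalSpace M] [ChartedSpace E M] [IsManifold 𝓘(ℝ, E) ∞ M]
  {J : ParaComplexStructure E M} (g : ParaNordenMetric J) (x : M)

@[simp] theorem form_apply (u v : TangentSpace 𝓘(ℝ, E) x) : g.form x u v = g.g x u v := rfl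

theorem form10_hat (X Y : TangentSpace 𝓘(ℝ, E) x) :
    g.form10 x (J.hat x X) (J.hat x Y) =
      (1 / 2 : ℝ) • (algebraMap ℝ ParaComplex (g.g x X Y)
        + paraUnit * algebraMap ℝ ParaComplex (g.g x X (J.I x Y))) :=
  g.hatForm_hat_hat x X Y

variable [FiniteDimensional ℝ E]

theorem form_bijective : Function.Bijective (g.form x) := by
  have hinj : Function.Injective (g.form x) := by
    rw [injective_iff_map_eq_zero]
    exact fun u hu ↦ g.nondegenerate x u fun v ↦ LinearMap.congr_fun hu v
  exact ⟨hinj, (LinearMap.injective_iff_surjective_of_finrank_eq_finrank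
    (Subspace.dual_finrank_eq (K := ℝ)).symm).1 hinj⟩

/-- Everything reduces to `g`, because `g(X, Y)` is twice the real part of `ĝ(X̂, Ŷ)`. A `C`-linear
functional `f` is determined by its real part, as `Im f(Ŷ) = Re f(eŶ) = Re f((IY)^)`; so the vector
representing `2 Re f` for `g` represents `f` for `ĝ`. -/
theorem form10_bijective : Function.Bijective (g.form10 x) := by
  constructor
  · rw [injective_iff_map_eq_zero]
    intro Z hZ
    obtain ⟨X, rfl⟩ := J.hat_surjective x Z
    have hX : X = 0 := g.nondegenerate x X fun Y ↦ by
      have h := congrArg QuadraticAlgebra.re (LinearMap.congr_fun hZ (J.hat x Y))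
      rw [form10_hat] at h
      simpa using h
    rw [hX]
    exact map_zero (J.hatₗ x)
  · intro f
    obtain ⟨X, hX⟩ := (g.form_bijective x).2 ((2 : ℝ) •
      (QuadraticAlgebra.reₗ (R := ℝ) 1 0 ∘ₗ f.restrictScalars ℝ ∘ₗ J.hatₗ x))
    have hX' (Y) : g.g x X Y = 2 * (f (J.hat x Y)).re := LinearMap.congr_fun hX Y
    refine ⟨J.hat x X, LinearMap.ext fun Z ↦ ?_⟩
    obtain ⟨Y, rfl⟩ := J.hat_surjective x Z
    rw [form10_hat, hX', hX', J.hat_I, map_smul]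
    ext <;> simp

end ParaNordenMetric

end ParaNorden

end

noncomputable section

namespace ParaNorden

open ParaNordenMetric Matrix

/-! ### Calculus of matrices of functions of the coordinates -/

section MatrixCalculus

variable {E : Type*} [NormedAddCommGroup E] [NormedSpace ℝ E] {ι : Type*}

/-- All entries of the matrix of functions `A` are `C^n` near `p`. -/
def MatrixContDiffAt (n : ℕ∞) (A : E → Matrix ι ι ℝ) (p : E) : Prop :=
  ∀ i j, ContDiffAt ℝ n (fun q ↦ A q i j) p

variable {n : ℕ∞} {A B : E → Matrix ι ι ℝ} {p : E}

theorem MatrixContDiffAt.of_le {m : ℕ∞} (hA : MatrixContDiffAt m A p) (h : n ≤ m) :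
    MatrixContDiffAt n A p := fun i j ↦ (hA i j).of_le (by exact_mod_cast h)

theorem MatrixContDiffAt.transpose (hA : MatrixContDiffAt n A p) :
    MatrixContDiffAt n (fun q ↦ (A q)ᵀ) p := fun i j ↦ hA j i

theorem MatrixContDiffAt.mul [Fintype ι] (hA : MatrixContDiffAt n A p)
    (hB : MatrixContDiffAt n B p) : MatrixContDiffAt n (fun q ↦ A q * B q) p := fun i j ↦ by
  simp only [Matrix.mul_apply]
  exact ContDiffAt.sum fun l _ ↦ (hA i l).mul (hB l j)

theorem MatrixContDiffAt.det [Fintype ι] [DecidableEq ι] (hA : MatrixContDiffAt n A p) :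
    ContDiffAt ℝ n (fun q ↦ (A q).det) p := by
  simp only [Matrix.det_apply, Units.smul_def, zsmul_eq_mul]
  exact ContDiffAt.sum fun σ _ ↦ contDiffAt_const.mul (contDiffAt_prod fun i _ ↦ hA _ _)

theorem MatrixContDiffAt.inv [Fintype ι] [DecidableEq ι] (hA : MatrixContDiffAt n A p)
    (h : (A p).det ≠ 0) : MatrixContDiffAt n (fun q ↦ (A q)⁻¹) p := fun i j ↦ by
  simp only [Matrix.inv_def, Ring.inverse_eq_inv', Matrix.smul_apply, smul_eq_mul,
    Matrix.adjugate_apply]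
  -- Cramer's rule: an entry of the adjugate is the determinant of `A` with row `j` replaced by a
  -- constant vector.
  refine (hA.det.inv h).mul (MatrixContDiffAt.det fun a b ↦ ?_)
  by_cases hab : a = j
  · subst hab; simp only [Matrix.updateRow_self]; exact contDiffAt_const
  · simp only [Matrix.updateRow_ne hab]; exact hA a b

variable [FiniteDimensional ℝ E] {k l : Fin (Module.finrank ℝ E)}

/-- The entrywise partial derivative of a matrix of functions of the coordinates. -/
def matrixPderiv (k : Fin (Module.finrank ℝ E)) (A : E → Matrix ι ι ℝ) (p : E) : Matrix ι ι ℝ :=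
  Matrix.of fun i j ↦ pderiv k (fun q ↦ A q i j) p

theorem contDiffAt_pderiv {m : ℕ∞} {f : E → ℝ} (hf : ContDiffAt ℝ m f p) (hn : n + 1 ≤ m) :
    ContDiffAt ℝ n (pderiv k f) p :=
  (hf.fderiv_right (by exact_mod_cast hn)).clm_apply contDiffAt_const

theorem MatrixContDiffAt.matrixPderiv {m : ℕ∞} (hA : MatrixContDiffAt m A p) (hn : n + 1 ≤ m) :
    MatrixContDiffAt n (matrixPderiv k A) p := fun i j ↦ contDiffAt_pderiv (hA i j) hn

theorem matrixPderiv_congr (h : A =ᶠ[nhds p] B) : matrixPderiv k A p = matrixPderiv k B p := by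
  ext i j
  simp only [matrixPderiv, of_apply, pderiv]
  rw [Filter.EventuallyEq.fderiv_eq]
  filter_upwards [h] with q hq
  rw [hq]

theorem matrixPderiv_transpose : matrixPderiv k (fun q ↦ (A q)ᵀ) p = (matrixPderiv k A p)ᵀ := rfl

theorem matrixPderiv_add (hA : MatrixContDiffAt 1 A p) (hB : MatrixContDiffAt 1 B p) :
    matrixPderiv k (fun q ↦ A q + B q) p = matrixPderiv k A p + matrixPderiv k B p := by
  ext i j
  simp only [matrixPderiv, of_apply, pderiv, Matrix.add_apply]
  rw [fderiv_fun_add ((hA i j).differentiableAt (by simp)) ((hB i j).differentiableAt (by simp))]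
  rfl

theorem matrixPderiv_sub (hA : MatrixContDiffAt 1 A p) (hB : MatrixContDiffAt 1 B p) :
    matrixPderiv k (fun q ↦ A q - B q) p = matrixPderiv k A p - matrixPderiv k B p := by
  ext i j
  simp only [matrixPderiv, of_apply, pderiv, Matrix.sub_apply]
  rw [fderiv_fun_sub ((hA i j).differentiableAt (by simp)) ((hB i j).differentiableAt (by simp))]
  rfl

theorem matrixPderiv_mul [Fintype ι] (hA : MatrixContDiffAt 1 A p) (hB : MatrixContDiffAt 1 B p) :
    matrixPderiv k (fun q ↦ A q * B q) p = matrixPderiv k A p * B p + A p * matrixPderiv k B p := by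
  have dA i j := (hA i j).differentiableAt (by simp)
  have dB i j := (hB i j).differentiableAt (by simp)
  ext i j
  simp only [matrixPderiv, of_apply, pderiv, Matrix.add_apply, Matrix.mul_apply]
  rw [fderiv_fun_sum fun l _ ↦ (dA i l).fun_mul (dB l j), _root_.sum_apply,
    ← Finset.sum_add_distrib]
  refine Finset.sum_congr rfl fun l _ ↦ ?_
  rw [fderiv_fun_mul (dA i l) (dB l j)]
  simp only [_root_.add_apply, _root_.smul_apply, smul_eq_mul]
  ring

theorem matrixPderiv_comm (hA : MatrixContDiffAt 2 A p) :
    matrixPderiv k (matrixPderiv l A) p = matrixPderiv l (matrixPderiv k A) p := by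
  ext i j
  have h := hA i j
  have hd : DifferentiableAt ℝ (fderiv ℝ fun q ↦ A q i j) p :=
    (h.fderiv_right (m := 1) (by norm_num)).differentiableAt (by simp)
  have key (a b : Fin (Module.finrank ℝ E)) : matrixPderiv a (matrixPderiv b A) p i j =
      fderiv ℝ (fderiv ℝ fun q ↦ A q i j) p (Module.finBasis ℝ E a) (Module.finBasis ℝ E b) := by
    simp only [matrixPderiv, of_apply, pderiv]
    rw [fderiv_clm_apply hd (differentiableAt_const _)]
    simp
  rw [key, key]
  exact (h.isSymmSndFDerivAt (by simp)).eq _ _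

end MatrixCalculus

/-! ### Curvature of a metric in coordinates -/

section Curvature

variable {E : Type*} [NormedAddCommGroup E] [NormedSpace ℝ E] [FiniteDimensional ℝ E]
  {G J : E → Matrix (Fin (Module.finrank ℝ E)) (Fin (Module.finrank ℝ E)) ℝ} {U : Set E} {p : E}
  {i j k l : Fin (Module.finrank ℝ E)}

theorem curvatureMatrix_eq : curvatureMatrix pderiv G i j p =
    matrixPderiv i (christoffel pderiv G j) p - matrixPderiv j (christoffel pderiv G i) p
    + (christoffel pderiv G i p * christoffel pderiv G j p
      - christoffel pderiv G j p * christoffel pderiv G i p) := rfl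

theorem curvatureMatrix_swap :
    curvatureMatrix pderiv G i j p = -curvatureMatrix pderiv G j i p := by
  rw [curvatureMatrix_eq, curvatureMatrix_eq]; abel

/-- The Levi-Civita connection is torsion free. -/
theorem christoffel_comm (hG : ∀ q, (G q).IsSymm) :
    christoffel pderiv G i p k j = christoffel pderiv G j p k i := by
  have h (a b c) : pderiv c (fun q ↦ G q a b) p = pderiv c (fun q ↦ G q b a) p := by
    simp only [(hG _).apply a b]
  simp only [christoffel, of_apply]
  congr 1
  refine Finset.sum_congr rfl fun l _ ↦ ?_
  rw [h i j l]; ring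

/-- The first Bianchi identity. -/
theorem curvatureMatrix_bianchi (hG : ∀ q, (G q).IsSymm) :
    curvatureMatrix pderiv G i j p k l + curvatureMatrix pderiv G j l p k i
      + curvatureMatrix pderiv G l i p k j = 0 := by
  -- Torsion-freeness makes both the derivative terms and the quadratic terms symmetric in their
  -- last two lower indices; in the cyclic sum they then cancel in pairs.
  have h1 (a b c) : matrixPderiv a (christoffel pderiv G b) p k c =
      matrixPderiv a (christoffel pderiv G c) p k b := by
    simp only [matrixPderiv, of_apply, christoffel_comm (i := b) (j := c) hG]
  have h2 (a b c) : (christoffel pderiv G a p * christoffel pderiv G b p) k c =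
      (christoffel pderiv G a p * christoffel pderiv G c p) k b := by
    simp only [Matrix.mul_apply, christoffel_comm (i := b) (j := c) hG]
  simp only [curvatureMatrix_eq, Matrix.add_apply, Matrix.sub_apply]
  rw [h1 i j l, h1 j i l, h1 l i j, h2 i j l, h2 j i l, h2 l i j]
  ring

/-- The Christoffel symbols of the first kind. -/
theorem mul_christoffel_apply (hdet : (G p).det ≠ 0) :
    (G p * christoffel pderiv G i p) k j =
      1 / 2 * (matrixPderiv i G p j k + matrixPderiv j G p i k - matrixPderiv k G p i j) := by
  set v : Fin (Module.finrank ℝ E) → ℝ := fun l ↦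
    matrixPderiv i G p j l + matrixPderiv j G p i l - matrixPderiv l G p i j
  have h1 : (fun m ↦ christoffel pderiv G i p m j) = (1 / 2 : ℝ) • ((G p)⁻¹ *ᵥ v) := by
    ext m; rfl
  have h2 : (G p * christoffel pderiv G i p) k j =
      (G p *ᵥ fun m ↦ christoffel pderiv G i p m j) k := rfl
  rw [h2, h1, mulVec_smul, mulVec_mulVec, mul_nonsing_inv _ (isUnit_iff_ne_zero.2 hdet),
    one_mulVec]
  rfl

/-- The Levi-Civita connection is metric. -/
theorem matrixPderiv_metric (hG : ∀ q, (G q).IsSymm) (hdet : (G p).det ≠ 0) :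
    matrixPderiv i G p = G p * christoffel pderiv G i p + (G p * christoffel pderiv G i p)ᵀ := by
  have h (a b c) : matrixPderiv c G p a b = matrixPderiv c G p b a := by
    simp only [matrixPderiv, of_apply, (hG _).apply a b]
  ext a b
  rw [Matrix.add_apply, transpose_apply, mul_christoffel_apply hdet, mul_christoffel_apply hdet,
    h b a i, h i b a, h i a b]
  ring

theorem matrixContDiffAt_christoffel (hGp : MatrixContDiffAt 2 G p) (hdet : (G p).det ≠ 0) :
    MatrixContDiffAt 1 (christoffel pderiv G i) p := fun k j ↦ by
  simp only [christoffel, of_apply]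
  refine ContDiffAt.const_smul _ (ContDiffAt.sum fun l _ ↦
    (((hGp.of_le (by norm_num)).inv hdet) k l).mul ?_)
  have h (a b c) : ContDiffAt ℝ (1 : ℕ∞) (pderiv a fun q ↦ G q b c) p :=
    contDiffAt_pderiv (hGp b c) (by norm_num)
  exact ((h _ _ _).add (h _ _ _)).sub (h _ _ _)

/-- The curvature of the Levi-Civita connection is skew-adjoint. -/
theorem curvatureMatrix_skew (hU : IsOpen U) (hp : p ∈ U) (hG : ∀ q, (G q).IsSymm)
    (hdet : ∀ q ∈ U, (G q).det ≠ 0) (hGp : MatrixContDiffAt 2 G p) :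
    G p * curvatureMatrix pderiv G i j p + (G p * curvatureMatrix pderiv G i j p)ᵀ = 0 := by
  have hΓ (a) : MatrixContDiffAt 1 (christoffel pderiv G a) p :=
    matrixContDiffAt_christoffel hGp (hdet p hp)
  have hG1 : MatrixContDiffAt 1 G p := hGp.of_le (by norm_num)
  have h2 (a b) : matrixPderiv a (matrixPderiv b G) p =
      (matrixPderiv a G p * christoffel pderiv G b p
        + G p * matrixPderiv a (christoffel pderiv G b) p)
      + (matrixPderiv a G p * christoffel pderiv G b p
        + G p * matrixPderiv a (christoffel pderiv G b) p)ᵀ := by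
    have : matrixPderiv b G =ᶠ[nhds p]
        fun q ↦ G q * christoffel pderiv G b q + (G q * christoffel pderiv G b q)ᵀ := by
      filter_upwards [hU.mem_nhds hp] with q hq using matrixPderiv_metric hG (hdet q hq)
    rw [matrixPderiv_congr this, matrixPderiv_add (hG1.mul (hΓ b)) (hG1.mul (hΓ b)).transpose,
      matrixPderiv_transpose (A := fun q ↦ G q * christoffel pderiv G b q),
      matrixPderiv_mul hG1 (hΓ b)]
  -- Integrability condition of `∂_b G = GΓ_b + (GΓ_b)ᵀ`: equality of the mixed second derivatives
  -- of `G`, with first derivatives substituted back, is the claim.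
  have h := matrixPderiv_comm (k := i) (l := j) hGp
  rw [h2, h2, matrixPderiv_metric hG (hdet p hp), matrixPderiv_metric hG (hdet p hp)] at h
  rw [curvatureMatrix_eq, ← sub_eq_zero.2 h]
  simp only [transpose_mul, transpose_transpose, transpose_add, transpose_sub, (hG p).eq]
  noncomm_ring

/-- The curvature commutes with every parallel field `J` of endomorphisms. -/
theorem curvatureMatrix_commute (hU : IsOpen U) (hp : p ∈ U)
    (hdet : (G p).det ≠ 0) (hGp : MatrixContDiffAt 2 G p) (hJp : MatrixContDiffAt 2 J p)
    (hJ : ∀ q ∈ U, ∀ k, matrixPderiv k J q + christoffel pderiv G k q * J q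
      - J q * christoffel pderiv G k q = 0) :
    curvatureMatrix pderiv G i j p * J p = J p * curvatureMatrix pderiv G i j p := by
  have hΓ (a) : MatrixContDiffAt 1 (christoffel pderiv G a) p :=
    matrixContDiffAt_christoffel hGp hdet
  have hJ1 : MatrixContDiffAt 1 J p := hJp.of_le (by norm_num)
  have h1 (a) {q} (hq : q ∈ U) : matrixPderiv a J q =
      J q * christoffel pderiv G a q - christoffel pderiv G a q * J q := by
    rw [← sub_eq_zero, ← hJ q hq a]; abel
  have h2 (a b) : matrixPderiv a (matrixPderiv b J) p =
      (matrixPderiv a J p * christoffel pderiv G b p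
        + J p * matrixPderiv a (christoffel pderiv G b) p)
      - (matrixPderiv a (christoffel pderiv G b) p * J p
        + christoffel pderiv G b p * matrixPderiv a J p) := by
    have : matrixPderiv b J =ᶠ[nhds p]
        fun q ↦ J q * christoffel pderiv G b q - christoffel pderiv G b q * J q := by
      filter_upwards [hU.mem_nhds hp] with q hq using h1 b hq
    rw [matrixPderiv_congr this, matrixPderiv_sub (hJ1.mul (hΓ b)) ((hΓ b).mul hJ1),
      matrixPderiv_mul hJ1 (hΓ b), matrixPderiv_mul (hΓ b) hJ1]
  -- The same argument for the equation `∂_b J = JΓ_b - Γ_b J`.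
  have h := matrixPderiv_comm (k := i) (l := j) hJp
  rw [h2, h2, h1 i hp, h1 j hp] at h
  symm
  rw [curvatureMatrix_eq, ← sub_eq_zero, ← sub_eq_zero.2 h]
  noncomm_ring

end Curvature

/-! ### Algebraic curvature tensors commuting with a para-complex structure -/

section Algebraic

variable {V : Type*} [AddCommGroup V] [Module ℝ V] {R : V →ₗ[ℝ] V →ₗ[ℝ] V →ₗ[ℝ] V}
  {b : LinearMap.BilinForm ℝ V} {I : V →ₗ[ℝ] V}

/-- The pair symmetry of algebraic curvature tensors. -/
theorem curvature_pair_symm (hR : ∀ X Y Z, R X Y Z = -R Y X Z)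
    (hB : ∀ X Y Z, R X Y Z + R Y Z X + R Z X Y = 0)
    (hs : ∀ X Y Z W, b (R X Y Z) W = -b (R X Y W) Z) (X Y Z W : V) :
    b (R X Y Z) W = b (R Z W X) Y := by
  have hB' (X Y Z W) : b (R X Y Z) W + b (R Y Z X) W + b (R Z X Y) W = 0 := by
    rw [← LinearMap.add_apply, ← map_add, ← LinearMap.add_apply, ← map_add, hB, map_zero,
      LinearMap.zero_apply]
  have hR' (X Y Z W) : b (R X Y Z) W = -b (R Y X Z) W := by
    rw [hR, map_neg, LinearMap.neg_apply]
  -- The classical octahedron argument: the four Bianchi identities on `X, Y, Z, W`, combined by the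
  -- two skew symmetries.
  linarith [hB' X Y Z W, hB' Y Z W X, hB' Z W X Y, hB' W X Y Z, hs X Y Z W, hs Y Z X W, hs Z X Y W,
    hs Y Z W X, hs Z W Y X, hs W Y Z X, hs Z W X Y, hs W X Z Y, hs X Z W Y, hs W X Y Z,
    hs X Y W Z, hs Y W X Z, hR' X Y Z W, hR' X Z Y W, hR' W X Y Z, hR' W Y X Z, hR' W Y Z X,
    hR' X Z W Y, hR' Y W X Z, hR' Y W Z X, hR' X Y W Z, hR' Z X Y W, hR' Z X W Y]

/-- If `R` commutes with the self-adjoint endomorphism `I`, then it is `I`-linear in its first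
argument. -/
theorem curvature_apply_left (hR : ∀ X Y Z, R X Y Z = -R Y X Z)
    (hB : ∀ X Y Z, R X Y Z + R Y Z X + R Z X Y = 0)
    (hs : ∀ X Y Z W, b (R X Y Z) W = -b (R X Y W) Z)
    (hb : ∀ X, (∀ Y, b X Y = 0) → X = 0)
    (hbI : ∀ X Y, b (I X) Y = b X (I Y)) (hRI : ∀ X Y Z, R X Y (I Z) = I (R X Y Z)) (X Y Z : V) :
    R (I X) Y Z = I (R X Y Z) := by
  have hswap (X Y Z) : R (I X) Y Z = R X (I Y) Z := by
    rw [← sub_eq_zero]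
    refine hb _ fun W ↦ ?_
    rw [map_sub, LinearMap.sub_apply, sub_eq_zero, curvature_pair_symm hR hB hs, hRI, hbI,
      curvature_pair_symm hR hB hs]
  -- The defect `S` is skew in its first two arguments (by `hswap`) and symmetric in its last two
  -- (Bianchi at `IX, Y, Z` minus `I` of Bianchi at `X, Y, Z`). Alternating these symmetries gives
  -- `S = -S`.
  set S : V → V → V → V := fun X Y Z ↦ R (I X) Y Z - I (R X Y Z) with hS
  have h12 (X Y Z) : S X Y Z = -S Y X Z := by
    simp only [hS]; rw [hswap, hR, hR X Y, map_neg]; abel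
  have h23 (X Y Z) : S X Y Z = S X Z Y := by
    have h1 := hB (I X) Y Z
    have h2 := congrArg I (hB X Y Z)
    rw [map_add, map_add, map_zero] at h2
    rw [hRI, hR Z (I X)] at h1
    rw [hR Z X, map_neg] at h2
    simp only [hS]
    rw [← sub_eq_zero]
    have h3 := sub_eq_zero.2 (h1.trans h2.symm)
    rw [← h3]; abel
  have h0 : S X Y Z = -S X Y Z :=
    calc S X Y Z = -S Y X Z := h12 ..
      _ = -S Y Z X := by rw [h23]
      _ = S Z Y X := by rw [h12, neg_neg]
      _ = S Z X Y := h23 ..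
      _ = -S X Z Y := h12 ..
      _ = -S X Y Z := by rw [h23]
  have h2 : (2 : ℝ) • S X Y Z = 0 := by
    rw [two_smul]; nth_rewrite 1 [h0]; exact neg_add_cancel _
  exact sub_eq_zero.1 ((smul_eq_zero.1 h2).resolve_left two_ne_zero)

end Algebraic

end ParaNorden

end

noncomputable section

namespace ParaNorden

open ParaNordenMetric Matrix

variable {E : Type*} [NormedAddCommGroup E] [NormedSpace ℝ E] [FiniteDimensional ℝ E]
  {M : Type*} [TopologicalSpace M] [ChartedSpace E M] [IsManifold 𝓘(ℝ, E) ∞ M]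

/-! ### Coordinate components of the metric and of the para-complex structure -/

section Smoothness

variable {φ : OpenPartialHomeomorph M E}

/-- The coordinate field is the tangent map of `φ.symm` applied to a constant field. -/
theorem contMDiffOn_coordVec (hφ : φ ∈ atlas E M) (i : Fin (Module.finrank ℝ E)) :
    ContMDiffOn 𝓘(ℝ, E) 𝓘(ℝ, E).tangent ∞
      (fun p ↦ (⟨φ.symm p, coordVec φ p i⟩ : TangentBundle 𝓘(ℝ, E) M)) φ.target := by
  have hs : ContMDiffOn 𝓘(ℝ, E) 𝓘(ℝ, E) ∞ φ.symm φ.target :=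
    contMDiffOn_symm_of_mem_maximalAtlas (IsManifold.subset_maximalAtlas hφ)
  have ht := hs.contMDiffOn_tangentMapWithin (m := ∞) (by simp)
    φ.open_target.uniqueMDiffOn
  have hc : ContMDiffOn 𝓘(ℝ, E) 𝓘(ℝ, E).tangent ∞
      (fun p ↦ (⟨p, Module.finBasis ℝ E i⟩ : TangentBundle 𝓘(ℝ, E) E)) φ.target :=
    contMDiffOn_vectorSpace_iff_contDiffOn.2 contDiffOn_const
  refine (ht.comp hc fun p hp ↦ hp).congr fun p hp ↦ ?_
  simp only [Function.comp_apply, tangentMapWithin, coordVec,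
    mfderivWithin_of_isOpen φ.open_target hp]

theorem contDiffOn_coordMatrix (hφ : φ ∈ atlas E M) {J : ParaComplexStructure E M}
    (g : ParaNordenMetric J) (i j : Fin (Module.finrank ℝ E)) :
    ContDiffOn ℝ ∞ (fun p ↦ g.coordMatrix φ p i j) φ.target := by
  rw [← contMDiffOn_iff_contDiffOn]
  have hs : ContMDiffOn 𝓘(ℝ, E) 𝓘(ℝ, E) ∞ φ.symm φ.target :=
    contMDiffOn_symm_of_mem_maximalAtlas (IsManifold.subset_maximalAtlas hφ)
  have : ContMDiffOn 𝓘(ℝ, E) (𝓘(ℝ, E).prod 𝓘(ℝ)) ∞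
      (fun p ↦ TotalSpace.mk' ℝ (E := Bundle.Trivial M ℝ) (φ.symm p) (g.coordMatrix φ p i j))
      φ.target := by
    apply ContMDiffOn.clm_bundle_apply₂ (F₁ := E) (F₂ := E)
    · exact g.smooth.comp_contMDiffOn hs
    · exact contMDiffOn_coordVec hφ i
    · exact contMDiffOn_coordVec hφ j
  intro p hp
  have h := this p hp
  simp only [contMDiffWithinAt_totalSpace] at h
  exact h.2

theorem contDiffOn_coordMatrix_I (hφ : φ ∈ atlas E M) (J : ParaComplexStructure E M)
    (i j : Fin (Module.finrank ℝ E)) :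
    ContDiffOn ℝ ∞ (fun p ↦ J.coordMatrix φ p i j) φ.target := by
  have hs : ContMDiffOn 𝓘(ℝ, E) 𝓘(ℝ, E) ∞ φ.symm φ.target :=
    contMDiffOn_symm_of_mem_maximalAtlas (IsManifold.subset_maximalAtlas hφ)
  have hφ' : ContMDiffOn 𝓘(ℝ, E) 𝓘(ℝ, E) ∞ φ φ.source :=
    contMDiffOn_of_mem_maximalAtlas (IsManifold.subset_maximalAtlas hφ)
  have ht := hφ'.contMDiffOn_tangentMapWithin (m := ∞) (by simp)
    φ.open_source.uniqueMDiffOn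
  have h1 : ContMDiffOn 𝓘(ℝ, E) 𝓘(ℝ, E).tangent ∞
      (fun p ↦ (⟨φ.symm p, J.I (φ.symm p) (coordVec φ p j)⟩ : TangentBundle 𝓘(ℝ, E) M))
      φ.target := by
    apply ContMDiffOn.clm_bundle_apply (F₁ := E) (F₂ := E)
    · exact J.smooth.comp_contMDiffOn hs
    · exact contMDiffOn_coordVec hφ j
  have h2 := (contMDiff_snd_tangentBundle_modelSpace E 𝓘(ℝ, E)).comp_contMDiffOn
    (ht.comp h1 fun p hp ↦ φ.map_target hp)
  have h3 : ContDiffOn ℝ ∞ (fun p ↦ (mfderiv 𝓘(ℝ, E) 𝓘(ℝ, E) φ (φ.symm p)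
      (J.I (φ.symm p) (coordVec φ p j)) : E)) φ.target := by
    refine contMDiffOn_iff_contDiffOn.1 (h2.congr fun p hp ↦ ?_)
    exact congrArg (fun L : E →L[ℝ] E ↦ L (J.I (φ.symm p) (coordVec φ p j)))
      (mfderivWithin_of_isOpen φ.open_source (φ.map_target hp)).symm
  exact (((Module.finBasis ℝ E).coord i).toContinuousLinearMap.contDiff.comp_contDiffOn h3)

end Smoothness

section Components

variable {φ : OpenPartialHomeomorph M E} (hφ : φ ∈ atlas E M) {x : M} (hx : x ∈ φ.source)
  {J : ParaComplexStructure E M} (g : ParaNordenMetric J)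

theorem coordMatrix_isSymm (p : E) : (g.coordMatrix φ p).IsSymm :=
  Matrix.IsSymm.ext fun _ _ ↦ g.symm _ _ _

theorem coordMatrix_apply (i j : Fin (Module.finrank ℝ E)) :
    g.coordMatrix φ (φ x) i j = g.g x (coordBasis hφ hx i) (coordBasis hφ hx j) := by
  -- `φ.symm (φ x) = x` is not definitional; since every tangent space is a copy of `E`, the base
  -- point can be generalized and substituted.
  have key (y : M) (h : y = x) (u v : E) :
      g.g y (u : TangentSpace 𝓘(ℝ, E) y) (v : TangentSpace 𝓘(ℝ, E) y) =
        g.g x (u : TangentSpace 𝓘(ℝ, E) x) (v : TangentSpace 𝓘(ℝ, E) x) := by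
    subst h; rfl
  exact key _ (φ.left_inv hx) _ _

theorem coordMatrix_I_apply (i j : Fin (Module.finrank ℝ E)) :
    J.coordMatrix φ (φ x) i j = (coordBasis hφ hx).repr (J.I x (coordBasis hφ hx j)) i := by
  have key (y : M) (h : y = x) (u : E) :
      (mfderiv 𝓘(ℝ, E) 𝓘(ℝ, E) φ y (J.I y (u : TangentSpace 𝓘(ℝ, E) y)) : E) =
        mfderiv 𝓘(ℝ, E) 𝓘(ℝ, E) φ x (J.I x (u : TangentSpace 𝓘(ℝ, E) x)) := by
    subst h; rfl
  exact congrArg (fun w : E ↦ (Module.finBasis ℝ E).repr w i) (key _ (φ.left_inv hx) _)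

theorem toLin_coordMatrix_I : Matrix.toLin (coordBasis hφ hx) (coordBasis hφ hx)
    (J.coordMatrix φ (φ x)) = J.lin x := by
  rw [← Matrix.toLin_toMatrix (coordBasis hφ hx) (coordBasis hφ hx) (J.lin x)]
  congr 1
  ext i j
  rw [coordMatrix_I_apply hφ hx, LinearMap.toMatrix_apply]
  rfl

theorem det_coordMatrix_ne_zero (hφ : φ ∈ atlas E M) (hx : x ∈ φ.source) :
    (g.coordMatrix φ (φ x)).det ≠ 0 := by
  have hG : g.coordMatrix φ (φ x) = LinearMap.BilinForm.toMatrix (coordBasis hφ hx) (g.form x) := by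
    ext i j
    rw [coordMatrix_apply hφ hx, LinearMap.BilinForm.toMatrix_apply]
    rfl
  have hnd : (g.form x).Nondegenerate := by
    refine ⟨fun u hu ↦ g.nondegenerate x u hu, fun u hu ↦ g.nondegenerate x u fun v ↦ ?_⟩
    rw [g.symm]
    exact hu v
  rw [hG, ← Matrix.nondegenerate_iff_det_ne_zero]
  exact hnd.toMatrix _

/-! ### Symmetries of the curvature tensor of a para-Kähler Norden metric -/

theorem trilinearOfMatrix_basis {ι K V : Type*} [Fintype ι] [DecidableEq ι] [CommRing K]
    [AddCommGroup V] [Module K V] (B : Module.Basis ι K V) (R : ι → ι → Matrix ι ι K) (i j : ι) :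
    trilinearOfMatrix B R (B i) (B j) = Matrix.toLin B B (R i j) := by
  simp [trilinearOfMatrix]

/-- An additive and homogeneous property that holds on a basis holds everywhere. -/
theorem basis_induction {ι K V : Type*} [CommRing K] [AddCommGroup V] [Module K V]
    (B : Module.Basis ι K V) {P : V → Prop} (h : ∀ i, P (B i)) (h0 : P 0)
    (hadd : ∀ u v, P u → P v → P (u + v)) (hsmul : ∀ (c : K) v, P v → P (c • v)) (v : V) : P v :=
  Submodule.span_induction (p := fun v _ ↦ P v) (by rintro _ ⟨i, rfl⟩; exact h i) h0
    (fun u v _ _ ↦ hadd u v) (fun c v _ ↦ hsmul c v) (B.mem_span v)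

theorem riemann_swap (X Y Z : TangentSpace 𝓘(ℝ, E) x) :
    g.riemann hφ hx X Y Z = -g.riemann hφ hx Y X Z := by
  have h : g.riemann hφ hx = -(g.riemann hφ hx).flip := by
    refine (coordBasis hφ hx).ext fun i ↦ (coordBasis hφ hx).ext fun j ↦ ?_
    rw [LinearMap.neg_apply, LinearMap.neg_apply, LinearMap.flip_apply, riemann,
      trilinearOfMatrix_basis, trilinearOfMatrix_basis, curvatureMatrix_swap, map_neg]
  exact LinearMap.congr_fun (LinearMap.congr_fun₂ h X Y) Z

theorem riemann_bianchi (X Y Z : TangentSpace 𝓘(ℝ, E) x) :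
    g.riemann hφ hx X Y Z + g.riemann hφ hx Y Z X + g.riemann hφ hx Z X Y = 0 := by
  have cyc {a b c : TangentSpace 𝓘(ℝ, E) x} (h : a + b + c = 0) : b + c + a = 0 := by
    rw [← h]; abel
  have hadd {a b c a' b' c' : TangentSpace 𝓘(ℝ, E) x} (h : a + b + c = 0) (h' : a' + b' + c' = 0) :
      (a + a') + (b + b') + (c + c') = 0 := by
    rw [← add_zero (0 : TangentSpace 𝓘(ℝ, E) x)]; nth_rewrite 1 [← h]; rw [← h']; abel
  have hsmul (r : ℝ) {a b c : TangentSpace 𝓘(ℝ, E) x} (h : a + b + c = 0) :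
      r • a + r • b + r • c = 0 := by
    rw [← smul_add, ← smul_add, h, smul_zero]
  refine basis_induction (coordBasis hφ hx)
    (P := fun X ↦ g.riemann hφ hx X Y Z + g.riemann hφ hx Y Z X + g.riemann hφ hx Z X Y = 0)
    (fun i ↦ ?_) (by simp) (fun u v hu hv ↦ by simpa using hadd hu hv)
    (fun c v hv ↦ by simpa using hsmul c hv) X
  refine basis_induction (coordBasis hφ hx)
    (P := fun Y ↦ g.riemann hφ hx (coordBasis hφ hx i) Y Z
      + g.riemann hφ hx Y Z (coordBasis hφ hx i)
      + g.riemann hφ hx Z (coordBasis hφ hx i) Y = 0)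
    (fun j ↦ ?_) (by simp) (fun u v hu hv ↦ by simpa using hadd hu hv)
    (fun c v hv ↦ by simpa using hsmul c hv) Y
  refine basis_induction (coordBasis hφ hx)
    (P := fun Z ↦ g.riemann hφ hx (coordBasis hφ hx i) (coordBasis hφ hx j) Z
      + g.riemann hφ hx (coordBasis hφ hx j) Z (coordBasis hφ hx i)
      + g.riemann hφ hx Z (coordBasis hφ hx i) (coordBasis hφ hx j) = 0)
    (fun l ↦ ?_) (by simp) (fun u v hu hv ↦ by simpa using hadd hu hv)
    (fun c v hv ↦ by simpa using hsmul c hv) Z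
  simp only [riemann, trilinearOfMatrix_basis, Matrix.toLin_self]
  rw [← Finset.sum_add_distrib, ← Finset.sum_add_distrib]
  refine Finset.sum_eq_zero fun k _ ↦ ?_
  rw [← add_smul, ← add_smul, curvatureMatrix_bianchi (coordMatrix_isSymm g), zero_smul]

theorem det_coordMatrix_ne_zero_of_mem_target (hφ : φ ∈ atlas E M) {p : E} (hp : p ∈ φ.target) :
    (g.coordMatrix φ p).det ≠ 0 := by
  have h := det_coordMatrix_ne_zero g hφ (φ.map_target hp)
  rwa [φ.right_inv hp] at h

theorem matrixContDiffAt_coordMatrix (hφ : φ ∈ atlas E M) {p : E} (hp : p ∈ φ.target) :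
    MatrixContDiffAt 2 (g.coordMatrix φ) p := fun i j ↦
  ((contDiffOn_coordMatrix hφ g i j).contDiffAt (φ.open_target.mem_nhds hp)).of_le
    (by exact_mod_cast le_top)

theorem matrixContDiffAt_coordMatrix_I (hφ : φ ∈ atlas E M) (J : ParaComplexStructure E M) {p : E}
    (hp : p ∈ φ.target) : MatrixContDiffAt 2 (J.coordMatrix φ) p := fun i j ↦
  ((contDiffOn_coordMatrix_I hφ J i j).contDiffAt (φ.open_target.mem_nhds hp)).of_le
    (by exact_mod_cast le_top)

theorem riemann_skew (X Y Z W : TangentSpace 𝓘(ℝ, E) x) :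
    g.form x (g.riemann hφ hx X Y Z) W = -g.form x (g.riemann hφ hx X Y W) Z := by
  have key (i j : Fin (Module.finrank ℝ E)) :
      (g.form x ∘ₗ g.riemann hφ hx (coordBasis hφ hx i) (coordBasis hφ hx j)) =
        -(g.form x ∘ₗ g.riemann hφ hx (coordBasis hφ hx i) (coordBasis hφ hx j)).flip := by
    refine (coordBasis hφ hx).ext fun l ↦ (coordBasis hφ hx).ext fun m ↦ ?_
    have hform (a b : Fin (Module.finrank ℝ E)) : g.form x (g.riemann hφ hx (coordBasis hφ hx i)
        (coordBasis hφ hx j) (coordBasis hφ hx a)) (coordBasis hφ hx b) =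
        (g.coordMatrix φ (φ x) * curvatureMatrix pderiv (g.coordMatrix φ) i j (φ x)) b a := by
      rw [riemann, trilinearOfMatrix_basis, Matrix.toLin_self, map_sum, LinearMap.sum_apply,
        Matrix.mul_apply]
      refine Finset.sum_congr rfl fun k _ ↦ ?_
      rw [map_smul, LinearMap.smul_apply, coordMatrix_apply hφ hx, form_apply, g.symm, smul_eq_mul,
        mul_comm]
    have h := congrFun (congrFun (curvatureMatrix_skew (i := i) (j := j) φ.open_target
      (φ.map_source hx) (coordMatrix_isSymm g)
      (fun q hq ↦ det_coordMatrix_ne_zero_of_mem_target g hφ hq)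
      (matrixContDiffAt_coordMatrix g hφ (φ.map_source hx))) m) l
    rw [Matrix.add_apply, Matrix.transpose_apply, ← hform, ← hform] at h
    simp only [LinearMap.neg_apply, LinearMap.flip_apply, LinearMap.comp_apply]
    exact eq_neg_of_add_eq_zero_left h
  refine basis_induction (coordBasis hφ hx)
    (P := fun X ↦ g.form x (g.riemann hφ hx X Y Z) W = -g.form x (g.riemann hφ hx X Y W) Z)
    (fun i ↦ ?_) (by simp)
    (fun u v hu hv ↦ by simp only [map_add, LinearMap.add_apply, hu, hv, neg_add])
    (fun c v hv ↦ by simp only [map_smul, LinearMap.smul_apply, hv, smul_neg]) X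
  refine basis_induction (coordBasis hφ hx)
    (P := fun Y ↦ g.form x (g.riemann hφ hx (coordBasis hφ hx i) Y Z) W =
      -g.form x (g.riemann hφ hx (coordBasis hφ hx i) Y W) Z)
    (fun j ↦ LinearMap.congr_fun₂ (key i j) Z W) (by simp)
    (fun u v hu hv ↦ by simp only [map_add, LinearMap.add_apply, hu, hv, neg_add])
    (fun c v hv ↦ by simp only [map_smul, LinearMap.smul_apply, hv, smul_neg]) Y

theorem riemann_I (hg : g.IsParaKahler) (X Y Z : TangentSpace 𝓘(ℝ, E) x) :
    g.riemann hφ hx X Y (J.lin x Z) = J.lin x (g.riemann hφ hx X Y Z) := by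
  have h : g.riemann hφ hx X Y ∘ₗ J.lin x = J.lin x ∘ₗ g.riemann hφ hx X Y := by
    refine basis_induction (coordBasis hφ hx)
      (P := fun X ↦ g.riemann hφ hx X Y ∘ₗ J.lin x = J.lin x ∘ₗ g.riemann hφ hx X Y)
      (fun i ↦ ?_) (by simp) (fun u v hu hv ↦ ?_) (fun c v hv ↦ ?_) X
    · refine basis_induction (coordBasis hφ hx)
        (P := fun Y ↦ g.riemann hφ hx (coordBasis hφ hx i) Y ∘ₗ J.lin x =
          J.lin x ∘ₗ g.riemann hφ hx (coordBasis hφ hx i) Y)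
        (fun j ↦ ?_) (by simp) (fun u v hu hv ↦ ?_) (fun c v hv ↦ ?_) Y
      · rw [riemann, trilinearOfMatrix_basis, ← toLin_coordMatrix_I hφ hx, ← Matrix.toLin_mul,
          ← Matrix.toLin_mul, curvatureMatrix_commute φ.open_target (φ.map_source hx)
            (det_coordMatrix_ne_zero g hφ hx) (matrixContDiffAt_coordMatrix g hφ (φ.map_source hx))
            (matrixContDiffAt_coordMatrix_I hφ J (φ.map_source hx))
            fun q hq k ↦ hg φ hφ q hq k]
      · rw [map_add, LinearMap.add_comp, LinearMap.comp_add, hu, hv]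
      · rw [map_smul, LinearMap.smul_comp, LinearMap.comp_smul, hv]
    · rw [map_add, LinearMap.add_apply, LinearMap.add_comp, LinearMap.comp_add, hu, hv]
    · rw [map_smul, LinearMap.smul_apply, LinearMap.smul_comp, LinearMap.comp_smul, hv]
  exact LinearMap.congr_fun h Z

end Components

end ParaNorden

end

noncomputable section

namespace ParaNorden

open ParaNordenMetric Matrix

variable {E : Type*} [NormedAddCommGroup E] [NormedSpace ℝ E] [FiniteDimensional ℝ E]
  {M : Type*} [TopologicalSpace M] [ChartedSpace E M] [IsManifold 𝓘(ℝ, E) ∞ M]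

/-! ### The curvature tensor of the para-complex metric -/

/-- Includes singular matrices, where both inverses are zero by convention. Hence `christoffel_map`
holds at all points of `E` and may be used under a derivative. -/
theorem map_nonsing_inv {ι K L : Type*} [Fintype ι] [DecidableEq ι] [Field K] [CommRing L]
    [Nontrivial L] (f : K →+* L) (A : Matrix ι ι K) : (A.map f)⁻¹ = A⁻¹.map f := by
  by_cases h : A.det = 0
  · have h' : (A.map f).det = 0 := by
      rw [← RingHom.mapMatrix_apply, ← RingHom.map_det, h, map_zero]
    rw [nonsing_inv_apply_not_isUnit _ (by rw [h']; exact not_isUnit_zero),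
      nonsing_inv_apply_not_isUnit _ (by rw [h]; exact not_isUnit_zero),
      Matrix.map_zero _ f.map_zero]
  · refine inv_eq_right_inv ?_
    rw [← Matrix.map_mul, mul_nonsing_inv _ (isUnit_iff_ne_zero.2 h),
      Matrix.map_one _ f.map_zero f.map_one]

theorem pderivC_algebraMap (k : Fin (Module.finrank ℝ E)) (f : E → ℝ) (p : E) :
    pderivC k (fun q ↦ algebraMap ℝ ParaComplex (f q)) p =
      algebraMap ℝ ParaComplex (pderiv k f p) := by
  ext <;> simp [pderivC, pderiv]

variable (G : E → Matrix (Fin (Module.finrank ℝ E)) (Fin (Module.finrank ℝ E)) ℝ)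

theorem christoffel_map (k : Fin (Module.finrank ℝ E)) (p : E) :
    christoffel pderivC (fun q ↦ (G q).map (algebraMap ℝ ParaComplex)) k p =
      (christoffel pderiv G k p).map (algebraMap ℝ ParaComplex) := by
  ext1 i j
  simp only [christoffel, of_apply, map_apply, map_nonsing_inv, pderivC_algebraMap,
    Algebra.smul_def, map_mul, map_sum, map_add, map_sub, Algebra.algebraMap_self,
    RingHom.id_apply]

theorem curvatureMatrix_map (i j : Fin (Module.finrank ℝ E)) (p : E) :
    curvatureMatrix pderivC (fun q ↦ (G q).map (algebraMap ℝ ParaComplex)) i j p =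
      (curvatureMatrix pderiv G i j p).map (algebraMap ℝ ParaComplex) := by
  ext1 k l
  simp only [curvatureMatrix, christoffel_map, Matrix.add_apply, Matrix.sub_apply, of_apply,
    map_apply, Matrix.mul_apply, pderivC_algebraMap, map_add, map_sub, map_sum, map_mul]

variable {φ : OpenPartialHomeomorph M E} (hφ : φ ∈ atlas E M) {x : M} (hx : x ∈ φ.source)
  {J : ParaComplexStructure E M} (g : ParaNordenMetric J)

/-- In a real frame `ĝ` has real components, so all coordinate formulas for `ĝ` are images of those
for `g`. -/
theorem coordMatrixC_eq :
    g.coordMatrixC φ = fun p ↦ (g.coordMatrix φ p).map (algebraMap ℝ ParaComplex) := by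
  funext p
  ext1 i j
  simp only [coordMatrixC, hatForm, of_apply, map_apply, LinearMap.BilinForm.baseChange_tmul]
  ext <;> simp [coordMatrix, QuadraticAlgebra.re_one, QuadraticAlgebra.im_one]

omit [FiniteDimensional ℝ E] [IsManifold 𝓘(ℝ, E) ∞ M] in
theorem one_tmul_smul (c : ℝ) (v : TangentSpace 𝓘(ℝ, E) x) :
    (1 ⊗ₜ (c • v) : TangentC (E := E) x) = algebraMap ℝ ParaComplex c • (1 ⊗ₜ v) := by
  rw [TensorProduct.tmul_smul, algebraMap_smul]

/-- The curvature tensor of `ĝ` is the `C`-trilinear extension of the curvature tensor of `g`. -/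
theorem riemannC_tmul (X Y Z : TangentSpace 𝓘(ℝ, E) x) :
    g.riemannC hφ hx (1 ⊗ₜ X) (1 ⊗ₜ Y) (1 ⊗ₜ Z) = 1 ⊗ₜ g.riemann hφ hx X Y Z := by
  set B := coordBasis hφ hx with hB
  have hBC (i) : (1 ⊗ₜ B i : TangentC (E := E) x) = B.baseChange ParaComplex i :=
    (Module.Basis.baseChange_apply ..).symm
  refine basis_induction B
    (P := fun X ↦ g.riemannC hφ hx (1 ⊗ₜ X) (1 ⊗ₜ Y) (1 ⊗ₜ Z) = 1 ⊗ₜ g.riemann hφ hx X Y Z)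
    (fun i ↦ ?_) (by simp)
    (fun u v hu hv ↦ by simp only [TensorProduct.tmul_add, map_add, LinearMap.add_apply, hu, hv])
    (fun c v hv ↦ by simp only [one_tmul_smul, map_smul, LinearMap.smul_apply, hv]) X
  refine basis_induction B
    (P := fun Y ↦ g.riemannC hφ hx (1 ⊗ₜ B i) (1 ⊗ₜ Y) (1 ⊗ₜ Z) = 1 ⊗ₜ g.riemann hφ hx (B i) Y Z)
    (fun j ↦ ?_) (by simp)
    (fun u v hu hv ↦ by simp only [TensorProduct.tmul_add, map_add, LinearMap.add_apply, hu, hv])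
    (fun c v hv ↦ by simp only [one_tmul_smul, map_smul, LinearMap.smul_apply, hv]) Y
  refine basis_induction B
    (P := fun Z ↦ g.riemannC hφ hx (1 ⊗ₜ B i) (1 ⊗ₜ B j) (1 ⊗ₜ Z) =
      1 ⊗ₜ g.riemann hφ hx (B i) (B j) Z)
    (fun l ↦ ?_) (by simp)
    (fun u v hu hv ↦ by simp only [TensorProduct.tmul_add, map_add, hu, hv])
    (fun c v hv ↦ by simp only [one_tmul_smul, map_smul, hv]) Z
  rw [hBC, hBC, hBC, riemannC, riemann, ← hB, trilinearOfMatrix_basis, trilinearOfMatrix_basis,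
    Matrix.toLin_self, Matrix.toLin_self, TensorProduct.tmul_sum, coordMatrixC_eq]
  refine Finset.sum_congr rfl fun k _ ↦ ?_
  rw [curvatureMatrix_map, map_apply, one_tmul_smul, hBC]

/-! ### Para-Kähler case: `C`-trilinearity of the curvature and comparison of Ricci tensors. -/

section ParaKahler

variable (hg : g.IsParaKahler)

include hg

theorem riemann_I_left (X Y Z : TangentSpace 𝓘(ℝ, E) x) :
    g.riemann hφ hx (J.I x X) Y Z = J.I x (g.riemann hφ hx X Y Z) :=
  curvature_apply_left (I := J.lin x) (riemann_swap hφ hx g) (riemann_bianchi hφ hx g)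
    (riemann_skew hφ hx g) (g.nondegenerate x) (g.pure' x) (riemann_I hφ hx g hg) X Y Z

theorem riemann_I_middle (X Y Z : TangentSpace 𝓘(ℝ, E) x) :
    g.riemann hφ hx X (J.I x Y) Z = J.I x (g.riemann hφ hx X Y Z) := by
  rw [riemann_swap, riemann_I_left hφ hx g hg, ← map_neg, ← riemann_swap]

theorem riemann_I_right (X Y Z : TangentSpace 𝓘(ℝ, E) x) :
    g.riemann hφ hx X Y (J.I x Z) = J.I x (g.riemann hφ hx X Y Z) :=
  riemann_I hφ hx g hg X Y Z

omit [FiniteDimensional ℝ E] hg in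
theorem half_smul_hat_add (X : TangentSpace 𝓘(ℝ, E) x) :
    algebraMap ℝ ParaComplex (1 / 2) • ((J.hat x X : TangentC (E := E) x)
      + paraUnit • (J.hat x (J.I x X) : TangentC (E := E) x)) = J.hat x X := by
  rw [J.hat_I, Submodule.coe_smul, smul_smul, paraUnit_mul_self, one_smul, ← two_smul ParaComplex,
    smul_smul]
  have : algebraMap ℝ ParaComplex (1 / 2) * 2 = 1 := by
    rw [← map_ofNat (algebraMap ℝ ParaComplex) 2, ← map_mul]; norm_num
  rw [this, one_smul]

/-- `R̂(X̂, Ŷ) Ẑ = (R(X, Y) Z)^`. -/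
theorem riemannC_hat (X Y Z : TangentSpace 𝓘(ℝ, E) x) :
    g.riemannC hφ hx (J.hat x X) (J.hat x Y) (J.hat x Z) = J.hat x (g.riemann hφ hx X Y Z) := by
  -- The arguments are replaced by their hats one at a time, each time using `I`-linearity in that
  -- slot. In the second and first slots the two halves agree because `e · e = 1`.
  have h1 (X Y) : g.riemannC hφ hx (1 ⊗ₜ X) (1 ⊗ₜ Y) (J.hat x Z) =
      J.hat x (g.riemann hφ hx X Y Z) := by
    rw [J.coe_hat, map_smul, map_add, map_smul, riemannC_tmul, riemannC_tmul,
      riemann_I_right hφ hx g hg, J.coe_hat]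
  have h2 (X) : g.riemannC hφ hx (1 ⊗ₜ X) (J.hat x Y) (J.hat x Z) =
      J.hat x (g.riemann hφ hx X Y Z) := by
    rw [J.coe_hat x Y, map_smul, map_add, map_smul, LinearMap.smul_apply, LinearMap.add_apply,
      LinearMap.smul_apply, h1, h1, riemann_I_middle hφ hx g hg, half_smul_hat_add]
  rw [J.coe_hat x X, map_smul, map_add, map_smul, LinearMap.smul_apply, LinearMap.smul_apply,
    LinearMap.add_apply, LinearMap.add_apply, LinearMap.smul_apply, LinearMap.smul_apply, h2, h2,
    riemann_I_left hφ hx g hg, half_smul_hat_add]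

/-- The projection in `riemann10` acts trivially, as the value already lies in `T^{1,0}`. -/
theorem riemann10_hat (X Y Z : TangentSpace 𝓘(ℝ, E) x) :
    g.riemann10 hφ hx (J.hat x X) (J.hat x Y) (J.hat x Z) = J.hat x (g.riemann hφ hx X Y Z) := by
  have h : g.riemann10 hφ hx (J.hat x X) (J.hat x Y) (J.hat x Z) =
    J.proj10 x (g.riemannC hφ hx (J.hat x X) (J.hat x Y) (J.hat x Z)) := rfl
  rw [h, riemannC_hat hφ hx g hg]
  apply Subtype.ext
  have h' : (J.proj10 x (J.hat x (g.riemann hφ hx X Y Z)) : TangentC (E := E) x) =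
      algebraMap ℝ ParaComplex (1 / 2) • ((J.hat x (g.riemann hφ hx X Y Z) : TangentC (E := E) x)
        + paraUnit • J.linC x (J.hat x (g.riemann hφ hx X Y Z))) := rfl
  rw [h', J.mem_T10.1 (J.hat x (g.riemann hφ hx X Y Z)).2, ← Submodule.coe_smul, ← J.hat_I,
    half_smul_hat_add]

theorem ricci_I_right (X Y : TangentSpace 𝓘(ℝ, E) x) :
    g.ricci hφ hx X (J.I x Y) =
      LinearMap.trace ℝ _ (J.lin x ∘ₗ ((g.riemann hφ hx).flip X).flip Y) := by
  change LinearMap.trace ℝ _ (((g.riemann hφ hx).flip X).flip (J.I x Y)) = _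
  congr 1
  exact LinearMap.ext fun Z ↦ riemann_I_right hφ hx g hg Z X Y

theorem ricci_I_left (X Y : TangentSpace 𝓘(ℝ, E) x) :
    g.ricci hφ hx (J.I x X) Y = g.ricci hφ hx X (J.I x Y) := by
  rw [ricci_I_right hφ hx g hg]
  change LinearMap.trace ℝ _ (((g.riemann hφ hx).flip (J.I x X)).flip Y) = _
  congr 1
  exact LinearMap.ext fun Z ↦ riemann_I_middle hφ hx g hg Z X Y

theorem ricciHat_hat (X Y : TangentSpace 𝓘(ℝ, E) x) :
    g.ricciHat hφ hx (J.hat x X) (J.hat x Y) =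
      (1 / 2 : ℝ) • (algebraMap ℝ ParaComplex (g.ricci hφ hx X Y)
        + paraUnit * algebraMap ℝ ParaComplex (g.ricci hφ hx X (J.I x Y))) := by
  rw [ricci_I_right hφ hx g hg]
  exact J.trace_eq_of_hat x (((g.riemann10 hφ hx).flip (J.hat x X)).flip (J.hat x Y))
    (((g.riemann hφ hx).flip X).flip Y) fun Z ↦ riemann10_hat hφ hx g hg Z X Y

omit hg in
theorem g_ricciOp (X Y : TangentSpace 𝓘(ℝ, E) x) :
    g.g x (g.ricciOp hφ hx X) Y = g.ricci hφ hx X Y :=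
  raiseIndex_spec (g.form_bijective x) _ X Y

theorem ricciOpHat_hat (X : TangentSpace 𝓘(ℝ, E) x) :
    g.ricciOpHat hφ hx (J.hat x X) = J.hat x (g.ricciOp hφ hx X) := by
  refine (g.form10_bijective x).1 (LinearMap.ext fun Z ↦ ?_)
  obtain ⟨Y, rfl⟩ := J.hat_surjective x Z
  rw [form10_hat, g_ricciOp, g_ricciOp, ← ricciHat_hat hφ hx g hg]
  exact raiseIndex_spec (K := ParaComplex) (V := J.T10 x) (g.form10_bijective x) _ _ _

theorem ricciOp_I (X : TangentSpace 𝓘(ℝ, E) x) :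
    g.ricciOp hφ hx (J.I x X) = J.I x (g.ricciOp hφ hx X) := by
  refine (g.form_bijective x).1 (LinearMap.ext fun Y ↦ ?_)
  rw [form_apply, form_apply, g.pure', g_ricciOp, g_ricciOp, ricci_I_left hφ hx g hg]

end ParaKahler

end ParaNorden

end

theorem mainTheorem5 {E : Type*} [NormedAddCommGroup E] [NormedSpace ℝ E] [FiniteDimensional ℝ E]
    {M : Type*} [TopologicalSpace M] [ChartedSpace E M] [IsManifold 𝓘(ℝ, E) ∞ M]
    (J : ParaNorden.ParaComplexStructure E M) (g : ParaNorden.ParaNordenMetric J)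
    (hg : g.IsParaKahler)
    {φ : OpenPartialHomeomorph M E} (hφ : φ ∈ atlas E M) {x : M} (hx : x ∈ φ.source) :
    (∀ X Y : TangentSpace 𝓘(ℝ, E) x,
      g.ricci hφ hx (J.I x X) Y = g.ricci hφ hx X (J.I x Y)) ∧
    (∀ X Y : TangentSpace 𝓘(ℝ, E) x,
      g.ricci hφ hx (J.I x X) (J.I x Y) = g.ricci hφ hx X Y) ∧
    (∀ X : TangentSpace 𝓘(ℝ, E) x,
      g.ricciOp hφ hx (J.I x X) = J.I x (g.ricciOp hφ hx X)) ∧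
    (∀ X Y : TangentSpace 𝓘(ℝ, E) x,
      g.ricciHat hφ hx (J.hat x X) (J.hat x Y) =
        (1 / 2 : ℝ) • (algebraMap ℝ ParaNorden.ParaComplex (g.ricci hφ hx X Y)
          + ParaNorden.paraUnit *
            algebraMap ℝ ParaNorden.ParaComplex (g.ricci hφ hx X (J.I x Y)))) ∧
    (∀ X : TangentSpace 𝓘(ℝ, E) x,
      g.ricciOpHat hφ hx (J.hat x X) = J.hat x (g.ricciOp hφ hx X)) := by
  refine ⟨ParaNorden.ricci_I_left hφ hx g hg, fun X Y ↦ ?_, ParaNorden.ricciOp_I hφ hx g hg,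
    ParaNorden.ricciHat_hat hφ hx g hg, ParaNorden.ricciOpHat_hat hφ hx g hg⟩
  rw [ParaNorden.ricci_I_left hφ hx g hg, J.sq]
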